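/- Let $\sigma:\mathbb R\to\mathbb R$ be Lipschitz (with $\sigma'$ its derivative, set to $0$ at points where it does not exist), let $L\ge 1$, let $n_0\ge 1$ and let $x_1,\dots,x_n\in\mathbb R^{n_0}$. Consider the depth-$L$ bias-free fully connected network with layer widths $n_0,n_1,\dots,n_{L-1},n_L=n_0$, $$\alpha^{(0)}(x)=x,\qquad \tilde\alpha^{(\ell+1)}(x)=\tfrac{1}{\sqrt{n_\ell}}W^{(\ell)}\alpha^{(\ell)}(x),\qquad \alpha^{(\ell)}(x)=\sigma(\tilde\alpha^{(\ell)}(x)),\qquad f(x)=\tilde\alpha^{(L)}(x),$$ whose weights are i.i.d. standard Gaussian, and its input–output Jacobian $$J(x)=\tfrac{1}{\sqrt{n_{L-1}}}W^{(L-1)}\,D^{(L-1)}\tfrac{1}{\sqrt{n_{L-2}}}W^{(L-2)}\cdots D^{(1)}\tfrac{1}{\sqrt{n_0}}W^{(0)},\qquad D^{(k)}=\mathrm{diag}\big(\sigma'(\tilde\alpha^{(k)}(x))\big).$$ For $x,z\in\mathbb R^{n_0}$ let $S_0=\frac1{n_0}\begin{pmatrix}\|x\|_2^2 & x^Tz\\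 x^Tz&\|z\|_2^2\end{pmatrix}$ and, for $\ell\ge 0$, let $$\hat\alpha^{(\ell+1)}=\sigma(a),\quad \hat z^{(\ell+1)}=\sigma'(a)\,b,\quad (a,b)\sim\mathcal N(0,S_\ell),\qquad S_{\ell+1}=\begin{pmatrix}\mathbb E[(\hat\alpha^{(\ell+1)})^2] & \mathbb E[\hat\alpha^{(\ell+1)}\hat z^{(\ell+1)}]\\ \mathbb E[\hat\alpha^{(\ell+1)}\hat z^{(\ell+1)}] & \mathbb E[(\hat z^{(\ell+1)})^2]\end{pmatrix}.$$ Write $\mathbb E[(\hat z^{(\ell)})^2\mid z,x]$ for the lower right entry of $S_\ell$ (so it is $\|z\|_2^2/n_0$ for $\ell=0$), and set $$\tau=\sup_{1\le i\le n,\ \|z\|_2=1}\mathbb E[(\hat z^{(L-1)})^2\mid z,x_i].$$ There are absolute constants $c,C,\kappa>0$, independent of $\sigma$, $L$, $n_0$, $n$ and the data, such that, as soon as all the hidden widths $n_1,\dots,n_{L-1}$ are large enough (depending on $\sigma,L,n_0$ and the data), with probability at least $1-C\,n\,e^{-\kappa n_0}$, $$\|J(x_i)\|_{op}\le c\sqrt{n_0\tau}\qquad\text{for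 all } i=1,\dots,n.$$ If moreover $\sigma(x)=1/(1+e^{-x})$, then, again for all large enough hidden widths and with probability at least $1-C\,n\,e^{-\kappa n_0}$, $\|J(x_i)\|_{op}\le c/4^{L-1}$ for all $i$. -/

import Mathlib

open MeasureTheory ProbabilityTheory Filter
open scoped Matrix Matrix.Norms.L2Operator

noncomputable section

/-! ### Fully connected autoencoders of depth `L = H + 1`

`H` is the number of hidden layers, `n₀` the input and output dimension, and `w k` is the width of
the `(k + 1)`-st hidden layer. -/

/-- The width `n_ℓ` of layer `ℓ`: `n₀` for the input layer `ℓ = 0` and for the output layer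
`ℓ = H + 1`, and `w (ℓ - 1)` for the hidden layers `1 ≤ ℓ ≤ H`. -/
def layerWidth (n₀ : ℕ) {H : ℕ} (w : Fin H → ℕ) : ℕ → ℕ
  | 0 => n₀
  | ℓ + 1 => if h : ℓ < H then w ⟨ℓ, h⟩ else n₀

/-- The weight matrices `W^(0), …, W^(L-1)`; here `W^(ℓ)` maps layer `ℓ` to layer `ℓ + 1`. -/
abbrev Weights (n₀ : ℕ) {H : ℕ} (w : Fin H → ℕ) : Type :=
  (ℓ : Fin (H + 1)) → Fin (layerWidth n₀ w ((ℓ : ℕ) + 1)) → Fin (layerWidth n₀ w (ℓ : ℕ)) → ℝ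

/-- Random initialization: all entries of all weight matrices are independent standard
Gaussians. -/
def initLaw (n₀ : ℕ) {H : ℕ} (w : Fin H → ℕ) : Measure (Weights n₀ w) :=
  Measure.pi fun _ => Measure.pi fun _ => Measure.pi fun _ => gaussianReal 0 1

/-- The normalized weight matrix `W^(ℓ) / √n_ℓ`. -/
def scaledWeight {n₀ H : ℕ} {w : Fin H → ℕ} (W : Weights n₀ w) (ℓ : ℕ) (hℓ : ℓ < H + 1) :
    Matrix (Fin (layerWidth n₀ w (ℓ + 1))) (Fin (layerWidth n₀ w ℓ)) ℝ :=
  (1 / Real.sqrt (layerWidth n₀ w ℓ : ℝ)) • Matrix.of (W ⟨ℓ, hℓ⟩)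

/-- The activation vector of layer `ℓ ≤ H`: the input for `ℓ = 0`, and `σ` applied entrywise to
the preactivation `W^(ℓ) / √n_ℓ` times the activation of layer `ℓ` for layer `ℓ + 1`. -/
def activation (σ : ℝ → ℝ) {n₀ H : ℕ} {w : Fin H → ℕ} (W : Weights n₀ w)
    (x : EuclideanSpace ℝ (Fin n₀)) : (ℓ : ℕ) → ℓ < H + 1 → Fin (layerWidth n₀ w ℓ) → ℝ
  | 0, _ => fun i => x i
  | ℓ + 1, hℓ => fun i =>
      σ ((scaledWeight W ℓ (by omega) *ᵥ activation σ W x ℓ (by omega)) i)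

/-- The preactivation vector of layer `ℓ + 1`. -/
def preactivation (σ : ℝ → ℝ) {n₀ H : ℕ} {w : Fin H → ℕ} (W : Weights n₀ w)
    (x : EuclideanSpace ℝ (Fin n₀)) (ℓ : ℕ) (hℓ : ℓ < H + 1) :
    Fin (layerWidth n₀ w (ℓ + 1)) → ℝ :=
  scaledWeight W ℓ hℓ *ᵥ activation σ W x ℓ hℓ

/-- The output of the network: the preactivation of the last layer `L = H + 1`. -/
def network (σ : ℝ → ℝ) {n₀ H : ℕ} {w : Fin H → ℕ} (W : Weights n₀ w)
    (x : EuclideanSpace ℝ (Fin n₀)) : Fin (layerWidth n₀ w (H + 1)) → ℝ :=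
  preactivation σ W x H (Nat.lt_succ_self H)

/-- The Jacobian of the activation of layer `ℓ` with respect to the input, that is, the product
`∏_{k=1}^{ℓ} D^(k) (W^(k-1) / √n_{k-1})` with later factors on the left, where `D^(k)` is the
diagonal matrix of the derivative of `σ` at the preactivations of layer `k`. -/
def activationJacobian (σ : ℝ → ℝ) {n₀ H : ℕ} {w : Fin H → ℕ} (W : Weights n₀ w)
    (x : EuclideanSpace ℝ (Fin n₀)) :
    (ℓ : ℕ) → ℓ < H + 1 → Matrix (Fin (layerWidth n₀ w ℓ)) (Fin n₀) ℝ
  | 0, _ => (1 : Matrix (Fin n₀) (Fin n₀) ℝ)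
  | ℓ + 1, hℓ =>
      Matrix.diagonal (fun i => deriv σ (preactivation σ W x ℓ (by omega) i)) *
        (scaledWeight W ℓ (by omega) * activationJacobian σ W x ℓ (by omega))

/-- The input-output Jacobian
`J(x) = (W^(L-1) / √n_{L-1}) ∏_{k=1}^{L-1} D^(k) (W^(k-1) / √n_{k-1})`, where `L = H + 1`. -/
def jacobian (σ : ℝ → ℝ) {n₀ H : ℕ} {w : Fin H → ℕ} (W : Weights n₀ w)
    (x : EuclideanSpace ℝ (Fin n₀)) :
    Matrix (Fin (layerWidth n₀ w (H + 1))) (Fin n₀) ℝ :=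
  scaledWeight W H (Nat.lt_succ_self H) * activationJacobian σ W x H (Nat.lt_succ_self H)

/-! ### The infinite-width recursion -/

/-- The centered Gaussian law of a pair `(a, b)` with covariance matrix `S`. -/
def pairLaw (S : Matrix (Fin 2) (Fin 2) ℝ) : Measure (EuclideanSpace ℝ (Fin 2)) :=
  multivariateGaussian 0 S

/-- The second moment matrix of the pair `(α̂^(ℓ), ẑ^(ℓ))` for input `x` and direction `z`.
For `ℓ + 1` it is the second moment matrix of `(σ(a), σ'(a) b)`, where `(a, b)` is a centered
Gaussian pair with the second moment matrix of layer `ℓ` as its covariance; for `ℓ = 0` it is the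
normalized Gram matrix of `x` and `z`. -/
def momentMatrix (σ : ℝ → ℝ) {n₀ : ℕ} (x z : EuclideanSpace ℝ (Fin n₀)) :
    ℕ → Matrix (Fin 2) (Fin 2) ℝ
  | 0 => !![‖x‖ ^ 2 / n₀, inner ℝ x z / n₀; inner ℝ x z / n₀, ‖z‖ ^ 2 / n₀]
  | ℓ + 1 =>
      let μ := pairLaw (momentMatrix σ x z ℓ)
      !![∫ p, (σ (p 0)) ^ 2 ∂μ, ∫ p, σ (p 0) * (deriv σ (p 0) * p 1) ∂μ;
         ∫ p, σ (p 0) * (deriv σ (p 0) * p 1) ∂μ, ∫ p, (deriv σ (p 0) * p 1) ^ 2 ∂μ]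

/-- The limiting second moment `E[(ẑ^(ℓ))² | z^(0) = z, x]`. -/
def limitSecondMoment (σ : ℝ → ℝ) {n₀ : ℕ} (x z : EuclideanSpace ℝ (Fin n₀)) (ℓ : ℕ) : ℝ :=
  momentMatrix σ x z ℓ 1 1

/-- `τ`: the supremum of `E[(ẑ^(L-1))² | z^(0), x_i]`, `L = H + 1`, over the data points `x_i` and
the unit vectors `z^(0)`. For Lipschitz `σ` the set is bounded above. -/
def tau (σ : ℝ → ℝ) {n₀ n : ℕ} (X : Fin n → EuclideanSpace ℝ (Fin n₀)) (H : ℕ) : ℝ :=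
  sSup {t : ℝ | ∃ (i : Fin n) (z : EuclideanSpace ℝ (Fin n₀)),
    ‖z‖ = 1 ∧ t = limitSecondMoment σ (X i) z H}

end

/-! Fix an input `x` and a direction `z`. Given the layers up to `ℓ`, each row of `W^(ℓ)` sends the
activation and its tangent to a planar Gaussian whose covariance is their normalized Gram matrix
(`map_dotProduct_pair`), and distinct rows are independent. The next Gram matrix is therefore an
empirical mean of independent terms with expectation `layerMoment` of the present one. Chebyshev's
inequality and continuity of `layerMoment` give, by induction on the layer, convergence in
probability to `momentMatrix` (`tendsto_measure_gramAvg`).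

For a unit `z` the last hidden tangent then has mean square below `2τ` with probability close to
one. The output layer has `n₀` fresh Gaussian rows, so a Chernoff bound controls `‖J z‖²` by a
multiple of `n₀ τ`, with failure probability at most `(e⁻¹/5)^n₀` for a suitable constant
(`measure_sum_sq_gaussian_gt_le`). A net of at most `5^n₀` directions turns this into an operator
norm bound. The net does not depend on the widths, so convergence is needed for finitely many pairs
only.

Two points are delicate. Since `σ'` is merely measurable, continuity of `layerMoment` is obtained by
regressing `b` on `a` and putting the variance into the density, which fails at variance zero. And
for `τ = 0` the bound requires `J = 0` on the net. Both are settled by showing that a vanishing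
limit moment forces the finite-width vector to vanish identically (`activation_eq_zero`,
`tangent_eq_zero`). -/

/-! ### Gram matrices and planar Gaussian laws -/

theorem posSemidef_fin_two {a b c : ℝ} (h : ∀ x y : ℝ, 0 ≤ a * x ^ 2 + 2 * b * (x * y) + c * y ^ 2) :
    (!![a, b; b, c] : Matrix (Fin 2) (Fin 2) ℝ).PosSemidef := by
  refine Matrix.PosSemidef.of_dotProduct_mulVec_nonneg ?_ fun x => ?_
  · ext i j
    fin_cases i <;> fin_cases j <;> simp
  · have := h (x 0) (x 1)
    simp [Matrix.mulVec, dotProduct, Fin.sum_univ_two]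
    linarith

theorem Matrix.PosSemidef.fin_two {S : Matrix (Fin 2) (Fin 2) ℝ} (hS : S.PosSemidef) :
    0 ≤ S 0 0 ∧ 0 ≤ S 1 1 ∧ S 1 0 = S 0 1 ∧ S 0 1 ^ 2 ≤ S 0 0 * S 1 1 := by
  have h : S 1 0 = S 0 1 := by simpa using hS.isHermitian.apply 0 1
  have hdet := hS.det_nonneg
  rw [Matrix.det_fin_two, h] at hdet
  exact ⟨hS.diag_nonneg, hS.diag_nonneg, h, by nlinarith⟩

/-- The normalized Gram matrix of a pair of vectors. -/
noncomputable def gramAvg {m : ℕ} (α v : Fin m → ℝ) : Matrix (Fin 2) (Fin 2) ℝ :=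
  !![(α ⬝ᵥ α) / m, (α ⬝ᵥ v) / m; (α ⬝ᵥ v) / m, (v ⬝ᵥ v) / m]

theorem posSemidef_gramAvg {m : ℕ} (α v : Fin m → ℝ) : (gramAvg α v).PosSemidef := by
  refine posSemidef_fin_two fun x y => ?_
  have h : 0 ≤ (x • α + y • v) ⬝ᵥ (x • α + y • v) / m :=
    div_nonneg (by simpa using dotProduct_star_self_nonneg (x • α + y • v)) (Nat.cast_nonneg m)
  simp only [add_dotProduct, dotProduct_add, smul_dotProduct, dotProduct_smul, smul_eq_mul,
    dotProduct_comm v α] at h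
  convert h using 1
  ring

/-- The characteristic function factors over the coordinates of `u`, and the exponents `-(t₀ αⱼ + t₁
vⱼ)² / (2m)` add up to the quadratic form of `gramAvg`. So a fresh row depends on the past only
through the Gram matrix. -/
theorem map_dotProduct_pair {m : ℕ} (α v : Fin m → ℝ) :
    (Measure.pi fun _ : Fin m => gaussianReal 0 1).map
      (fun u => !₂[1 / Real.sqrt m * (u ⬝ᵥ α), 1 / Real.sqrt m * (u ⬝ᵥ v)]) =
      pairLaw (gramAvg α v) := by
  have hmeas : Measurable fun u : Fin m → ℝ =>
      (!₂[1 / Real.sqrt m * (u ⬝ᵥ α), 1 / Real.sqrt m * (u ⬝ᵥ v)] : EuclideanSpace ℝ (Fin 2)) := by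
    refine (WithLp.measurable_toLp 2 (Fin 2 → ℝ)).comp (measurable_pi_lambda _ fun i => ?_)
    fin_cases i <;> simp [dotProduct] <;> fun_prop
  have := Measure.isProbabilityMeasure_map (μ := Measure.pi fun _ : Fin m => gaussianReal 0 1)
    hmeas.aemeasurable
  rw [pairLaw]
  apply Measure.ext_of_charFun
  ext t
  rw [charFun_multivariateGaussian (posSemidef_gramAvg α v), charFun_apply,
    integral_map hmeas.aemeasurable (Measurable.aestronglyMeasurable (by fun_prop))]
  have h1 : ∀ u : Fin m → ℝ, Complex.exp
      ((inner ℝ (!₂[1 / Real.sqrt m * (u ⬝ᵥ α), 1 / Real.sqrt m * (u ⬝ᵥ v)] :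
        EuclideanSpace ℝ (Fin 2)) t : ℝ) * Complex.I) =
      ∏ j, Complex.exp (((1 / Real.sqrt m * (t 0 * α j + t 1 * v j) : ℝ) : ℂ) * u j * Complex.I) := by
    intro u
    rw [← Complex.exp_sum, ← Finset.sum_mul]
    congr 2
    simp only [PiLp.inner_apply, Fin.sum_univ_two, dotProduct]
    simp [Finset.mul_sum, ← Finset.sum_add_distrib]
    refine Finset.sum_congr rfl fun j _ => by ring
  simp_rw [h1]
  rw [integral_fintype_prod_eq_prod (f := fun j (y : ℝ) => Complex.exp
    (((1 / Real.sqrt m * (t 0 * α j + t 1 * v j) : ℝ) : ℂ) * y * Complex.I))]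
  simp_rw [← charFun_apply_real, charFun_gaussianReal]
  rw [← Complex.exp_sum]
  congr 1
  have hm : (1 / Real.sqrt m) ^ 2 = 1 / (m : ℝ) := by
    rw [div_pow, Real.sq_sqrt (Nat.cast_nonneg m), one_pow]
  simp only [NNReal.coe_one, Complex.ofReal_zero, mul_zero, zero_mul, Complex.ofReal_one, one_mul,
    zero_sub, inner_zero_right, gramAvg]
  simp only [← Complex.ofReal_pow, mul_pow, hm]
  have h2 : t ⬝ᵥ !![(α ⬝ᵥ α) / m, (α ⬝ᵥ v) / m; (α ⬝ᵥ v) / m, (v ⬝ᵥ v) / m] *ᵥ t =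
      ∑ j, 1 / (m : ℝ) * (t 0 * α j + t 1 * v j) ^ 2 := by
    simp [Matrix.mulVec, dotProduct, Fin.sum_univ_two, Finset.sum_div, Finset.mul_sum,
      Finset.sum_mul, ← Finset.sum_add_distrib]
    refine Finset.sum_congr rfl fun j _ => by ring
  rw [h2]
  push_cast
  rw [Finset.sum_neg_distrib, ← Finset.sum_div]

/-- Linear regression: `b` is a multiple of `a` plus independent noise whose variance is the Schur
complement. If `S 0 0 = 0`, positivity forces `S 0 1 = 0`, which agrees with division by zero giving
`0`. -/
theorem pairLaw_eq_map_prod {S : Matrix (Fin 2) (Fin 2) ℝ} (hS : S.PosSemidef) :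
    pairLaw S = ((gaussianReal 0 (S 0 0).toNNReal).prod
      (gaussianReal 0 (S 1 1 - S 0 1 ^ 2 / S 0 0).toNNReal)).map
      (fun p => !₂[p.1, S 0 1 / S 0 0 * p.1 + p.2]) := by
  obtain ⟨h00, h11, h10, hdet⟩ := hS.fin_two
  have hmeas : Measurable fun p : ℝ × ℝ =>
      (!₂[p.1, S 0 1 / S 0 0 * p.1 + p.2] : EuclideanSpace ℝ (Fin 2)) := by
    refine (WithLp.measurable_toLp 2 (Fin 2 → ℝ)).comp (measurable_pi_lambda _ fun i => ?_)
    fin_cases i <;> simp <;> fun_prop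
  have := Measure.isProbabilityMeasure_map (μ := (gaussianReal 0 (S 0 0).toNNReal).prod
      (gaussianReal 0 (S 1 1 - S 0 1 ^ 2 / S 0 0).toNNReal)) hmeas.aemeasurable
  rw [pairLaw]
  apply Measure.ext_of_charFun
  ext t
  rw [charFun_multivariateGaussian hS, charFun_apply,
    integral_map hmeas.aemeasurable (Measurable.aestronglyMeasurable (by fun_prop))]
  have h1 : ∀ p : ℝ × ℝ, Complex.exp
      ((inner ℝ (!₂[p.1, S 0 1 / S 0 0 * p.1 + p.2] : EuclideanSpace ℝ (Fin 2)) t : ℝ) *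
        Complex.I) =
      Complex.exp (((t 0 + t 1 * (S 0 1 / S 0 0) : ℝ) : ℂ) * p.1 * Complex.I) *
        Complex.exp ((t 1 : ℂ) * p.2 * Complex.I) := by
    intro p
    rw [← Complex.exp_add]
    congr 1
    simp [PiLp.inner_apply, Fin.sum_univ_two]
    ring
  simp_rw [h1]
  rw [integral_prod_mul (fun x : ℝ => Complex.exp
      (((t 0 + t 1 * (S 0 1 / S 0 0) : ℝ) : ℂ) * x * Complex.I))
      (fun y : ℝ => Complex.exp ((t 1 : ℂ) * y * Complex.I)), ← charFun_apply_real,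
      ← charFun_apply_real, charFun_gaussianReal, charFun_gaussianReal, ← Complex.exp_add]
  congr 1
  have hδ : 0 ≤ S 1 1 - S 0 1 ^ 2 / S 0 0 := by
    rcases h00.eq_or_lt with h | h
    · simp [← h, h11]
    · rw [sub_nonneg, div_le_iff₀ h]
      linarith
  rw [Real.coe_toNNReal _ h00, Real.coe_toNNReal _ hδ]
  have h2 : t ⬝ᵥ S *ᵥ t = S 0 0 * (t 0 + t 1 * (S 0 1 / S 0 0)) ^ 2 +
      (S 1 1 - S 0 1 ^ 2 / S 0 0) * t 1 ^ 2 := by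
    simp only [Matrix.mulVec, dotProduct, Fin.sum_univ_two, h10]
    rcases h00.eq_or_lt with h | h
    · have h01 : S 0 1 = 0 := by
        rw [← h, zero_mul] at hdet
        exact pow_eq_zero_iff two_ne_zero |>.1 (le_antisymm hdet (sq_nonneg _))
      simp [← h, h01]
      ring
    · field_simp
      ring
  rw [h2]
  simp only [inner_zero_right]
  push_cast
  ring

/-- One step of the infinite-width recursion for second moment matrices. -/
noncomputable def layerMoment (σ : ℝ → ℝ) (S : Matrix (Fin 2) (Fin 2) ℝ) :
    Matrix (Fin 2) (Fin 2) ℝ :=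
  !![∫ p, (σ (p 0)) ^ 2 ∂pairLaw S, ∫ p, σ (p 0) * (deriv σ (p 0) * p 1) ∂pairLaw S;
     ∫ p, σ (p 0) * (deriv σ (p 0) * p 1) ∂pairLaw S, ∫ p, (deriv σ (p 0) * p 1) ^ 2 ∂pairLaw S]

theorem momentMatrix_succ (σ : ℝ → ℝ) {n₀ : ℕ} (x z : EuclideanSpace ℝ (Fin n₀)) (ℓ : ℕ) :
    momentMatrix σ x z (ℓ + 1) = layerMoment σ (momentMatrix σ x z ℓ) := rfl

/-! ### One-dimensional Gaussian integrals as functions of the variance -/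

theorem integrable_sq_gaussianReal (v : NNReal) :
    Integrable (fun y : ℝ => y ^ 2) (gaussianReal 0 v) :=
  (memLp_id_gaussianReal 2).integrable_sq

theorem integral_sq_gaussianReal (v : NNReal) : ∫ y : ℝ, y ^ 2 ∂gaussianReal 0 v = v := by
  have := variance_fun_id_gaussianReal (μ := 0) (v := v)
  rwa [variance_of_integral_eq_zero (by fun_prop) (by simp)] at this

theorem integrable_gaussianReal_of_abs_le {φ : ℝ → ℝ} (hφ : Measurable φ) {B : ℝ}
    (hB : ∀ y, |φ y| ≤ B * (1 + y ^ 2)) (v : NNReal) : Integrable φ (gaussianReal 0 v) :=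
  (((integrable_const 1).add (integrable_sq_gaussianReal v)).const_mul B).mono'
    hφ.aestronglyMeasurable (Eventually.of_forall hB)

/-- Because `φ` is only measurable, the variance is kept in the density, where dominated convergence
applies. At `v₀ = 0` the law is a point mass and the argument breaks down. -/
theorem continuousAt_integral_gaussianReal {φ : ℝ → ℝ} (hφ : Measurable φ) {B : ℝ}
    (hB : ∀ y, |φ y| ≤ B * (1 + y ^ 2)) {v₀ : ℝ} (hv₀ : 0 < v₀) :
    ContinuousAt (fun v : ℝ => ∫ y, φ y ∂gaussianReal 0 v.toNNReal) v₀ := by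
  have hnear : ∀ᶠ v in nhds v₀, v₀ / 2 < v ∧ v < 2 * v₀ :=
    (eventually_gt_nhds (by linarith)).and (eventually_lt_nhds (by linarith))
  have hB0 : 0 ≤ B := by simpa using (abs_nonneg _).trans (hB 0)
  have key : ContinuousAt (fun v : ℝ => ∫ y, (Real.sqrt (2 * Real.pi * v))⁻¹ *
      Real.exp (-y ^ 2 / (2 * v)) * φ y) v₀ := by
    -- For `v₀ / 2 < v < 2 v₀` the prefactor is largest at `v₀ / 2` and the exponential at `2 v₀`.
    refine continuousAt_of_dominated (bound := fun y => (Real.sqrt (2 * Real.pi * (v₀ / 2)))⁻¹ *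
      Real.exp (-(1 / (4 * v₀)) * y ^ 2) * (B * (1 + y ^ 2))) ?_ ?_ ?_ ?_
    · exact Eventually.of_forall fun v => Measurable.aestronglyMeasurable (by fun_prop)
    · filter_upwards [hnear] with v hv
      refine Eventually.of_forall fun y => ?_
      have hvpos : 0 < v := by linarith
      rw [norm_mul, norm_mul, Real.norm_of_nonneg (by positivity), Real.norm_of_nonneg
        (Real.exp_pos _).le, Real.norm_eq_abs]
      have h1 : (Real.sqrt (2 * Real.pi * v))⁻¹ ≤ (Real.sqrt (2 * Real.pi * (v₀ / 2)))⁻¹ := by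
        apply inv_anti₀ (Real.sqrt_pos.2 (by positivity))
        apply Real.sqrt_le_sqrt
        have := hv.1.le
        gcongr
      have h2 : Real.exp (-y ^ 2 / (2 * v)) ≤ Real.exp (-(1 / (4 * v₀)) * y ^ 2) := by
        apply Real.exp_le_exp.2
        have : 1 / (4 * v₀) ≤ 1 / (2 * v) := by
          apply one_div_le_one_div_of_le (by positivity)
          linarith
        have h3 : -y ^ 2 / (2 * v) = -(1 / (2 * v)) * y ^ 2 := by ring
        rw [h3]
        nlinarith [sq_nonneg y]
      have h4 := hB y
      gcongr
    · have hb : 0 < 1 / (4 * v₀) := by positivity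
      have i1 := integrable_exp_neg_mul_sq hb
      have i2 : Integrable fun y : ℝ => y ^ 2 * Real.exp (-(1 / (4 * v₀)) * y ^ 2) := by
        simpa using integrable_rpow_mul_exp_neg_mul_sq hb (s := 2) (by norm_num)
      refine ((i1.add i2).const_mul ((Real.sqrt (2 * Real.pi * (v₀ / 2)))⁻¹ * B)).congr
        (Eventually.of_forall fun y => ?_)
      simp only [Pi.add_apply]
      ring
    · refine Eventually.of_forall fun y => ?_
      refine ContinuousAt.mul (ContinuousAt.mul ?_ ?_) continuousAt_const
      · refine ContinuousAt.inv₀ (by fun_prop) (Real.sqrt_pos.2 (by positivity)).ne'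
      · refine ContinuousAt.rexp ?_
        exact ContinuousAt.div (by fun_prop) (by fun_prop) (by positivity)
  refine key.congr ?_
  filter_upwards [hnear] with v hv
  have hvpos : 0 < v := by linarith
  rw [integral_gaussianReal_eq_integral_smul (by simpa using hvpos)]
  refine integral_congr_ae (Eventually.of_forall fun y => ?_)
  simp [gaussianPDFReal_def, Real.coe_toNNReal _ hvpos.le]

/-! ### Quadratic growth and continuity of the moment recursion -/

section Growth

variable {σ : ℝ → ℝ} {K : NNReal} (hσ : LipschitzWith K σ)
include hσ

theorem abs_deriv_le (y : ℝ) : |deriv σ y| ≤ K := by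
  simpa using norm_deriv_le_of_lipschitz hσ (x₀ := y)

theorem deriv_sq_le (y : ℝ) : deriv σ y ^ 2 ≤ (K : ℝ) ^ 2 :=
  sq_le_sq' (abs_le.1 (abs_deriv_le hσ y)).1 (abs_le.1 (abs_deriv_le hσ y)).2

theorem sq_le_of_lipschitzWith (y : ℝ) : σ y ^ 2 ≤ 2 * σ 0 ^ 2 + 2 * (K : ℝ) ^ 2 * y ^ 2 := by
  have h : |σ y - σ 0| ≤ K * |y| := by
    simpa [Real.dist_eq] using hσ.dist_le_mul y 0
  have h2 : (σ y - σ 0) ^ 2 ≤ (K : ℝ) ^ 2 * y ^ 2 := by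
    rw [← sq_abs, ← sq_abs y, ← mul_pow]
    exact pow_le_pow_left₀ (abs_nonneg _) h 2
  nlinarith [sq_nonneg (σ y - 2 * σ 0)]

theorem sq_growth (a b : ℝ) :
    |σ a ^ 2| ≤ (2 * σ 0 ^ 2 + 2 * (K : ℝ) ^ 2) * (1 + a ^ 2 + b ^ 2) := by
  rw [abs_of_nonneg (sq_nonneg _)]
  have h := sq_le_of_lipschitzWith hσ a
  nlinarith [mul_nonneg (sq_nonneg (σ 0)) (sq_nonneg a), mul_nonneg (sq_nonneg (σ 0)) (sq_nonneg b),
    mul_nonneg (sq_nonneg (K : ℝ)) (sq_nonneg b), sq_nonneg (K : ℝ)]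

theorem deriv_mul_sq_growth (a b : ℝ) :
    |(deriv σ a * b) ^ 2| ≤ (2 * σ 0 ^ 2 + 2 * (K : ℝ) ^ 2) * (1 + a ^ 2 + b ^ 2) := by
  rw [abs_of_nonneg (sq_nonneg _), mul_pow]
  have h := mul_le_mul_of_nonneg_right (deriv_sq_le hσ a) (sq_nonneg b)
  nlinarith [mul_nonneg (sq_nonneg (σ 0)) (sq_nonneg a), mul_nonneg (sq_nonneg (σ 0)) (sq_nonneg b),
    mul_nonneg (sq_nonneg (K : ℝ)) (sq_nonneg b), mul_nonneg (sq_nonneg (K : ℝ)) (sq_nonneg a),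
    sq_nonneg (K : ℝ), sq_nonneg (σ 0)]

theorem mul_deriv_mul_growth (a b : ℝ) :
    |σ a * (deriv σ a * b)| ≤ (2 * σ 0 ^ 2 + 2 * (K : ℝ) ^ 2) * (1 + a ^ 2 + b ^ 2) := by
  have h1 := sq_growth hσ a b
  have h2 := deriv_mul_sq_growth hσ a b
  rw [abs_of_nonneg (sq_nonneg _)] at h1 h2
  rw [abs_le]
  constructor <;> nlinarith [sq_nonneg (σ a + deriv σ a * b), sq_nonneg (σ a - deriv σ a * b)]

/-- After the regression of `b` on `a`, terms linear in the centered noise integrate to zero. What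
remains is rational in the entries of `S`, times one-dimensional integrals at variance `S 0 0`. -/
theorem layerMoment_eq {S : Matrix (Fin 2) (Fin 2) ℝ} (hS : S.PosSemidef) :
    layerMoment σ S 0 0 = ∫ y, σ y ^ 2 ∂gaussianReal 0 (S 0 0).toNNReal ∧
    layerMoment σ S 0 1 = S 0 1 / S 0 0 *
      ∫ y, σ y * (deriv σ y * y) ∂gaussianReal 0 (S 0 0).toNNReal ∧
    layerMoment σ S 1 1 = (S 0 1 / S 0 0) ^ 2 *
      ∫ y, (deriv σ y * y) ^ 2 ∂gaussianReal 0 (S 0 0).toNNReal +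
      (S 1 1 - S 0 1 ^ 2 / S 0 0) * ∫ y, deriv σ y ^ 2 ∂gaussianReal 0 (S 0 0).toNNReal := by
  obtain ⟨h00, h11, h10, hdet⟩ := hS.fin_two
  have hδ : 0 ≤ S 1 1 - S 0 1 ^ 2 / S 0 0 := by
    rcases h00.eq_or_lt with h | h
    · simp [← h, h11]
    · rw [sub_nonneg, div_le_iff₀ h]
      linarith
  have hσm := hσ.continuous.measurable
  have hdm := measurable_deriv σ
  have hmeas : Measurable fun p : ℝ × ℝ =>
      (!₂[p.1, S 0 1 / S 0 0 * p.1 + p.2] : EuclideanSpace ℝ (Fin 2)) := by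
    refine (WithLp.measurable_toLp 2 (Fin 2 → ℝ)).comp (measurable_pi_lambda _ fun i => ?_)
    fin_cases i <;> simp <;> fun_prop
  have hmap : ∀ F : EuclideanSpace ℝ (Fin 2) → ℝ, Measurable F →
      ∫ p, F p ∂pairLaw S = ∫ p, F !₂[p.1, S 0 1 / S 0 0 * p.1 + p.2]
        ∂((gaussianReal 0 (S 0 0).toNNReal).prod
          (gaussianReal 0 (S 1 1 - S 0 1 ^ 2 / S 0 0).toNNReal)) := fun F hF => by
    rw [pairLaw_eq_map_prod hS, integral_map hmeas.aemeasurable hF.aestronglyMeasurable]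
  set ρ := S 0 1 / S 0 0
  set δ := S 1 1 - S 0 1 ^ 2 / S 0 0
  set μ := gaussianReal 0 (S 0 0).toNNReal
  set ν := gaussianReal 0 δ.toNNReal
  have iy : Integrable (fun y : ℝ => y) ν := (memLp_id_gaussianReal 1).integrable (by simp)
  have iy2 : Integrable (fun y : ℝ => y ^ 2) ν := integrable_sq_gaussianReal _
  have i1 : Integrable (fun x => σ x * (deriv σ x * x)) μ :=
    integrable_gaussianReal_of_abs_le (by fun_prop)
      (B := 2 * (2 * σ 0 ^ 2 + 2 * (K : ℝ) ^ 2)) (fun y => (mul_deriv_mul_growth hσ y y).trans (by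
        nlinarith [sq_nonneg (K : ℝ), sq_nonneg (σ 0)])) _
  have i2 : Integrable (fun x => (deriv σ x * x) ^ 2) μ :=
    integrable_gaussianReal_of_abs_le (by fun_prop)
      (B := 2 * (2 * σ 0 ^ 2 + 2 * (K : ℝ) ^ 2)) (fun y => (deriv_mul_sq_growth hσ y y).trans (by
        nlinarith [sq_nonneg (K : ℝ), sq_nonneg (σ 0)])) _
  have i3 : Integrable (fun x => σ x * deriv σ x) μ :=
    integrable_gaussianReal_of_abs_le (by fun_prop)
      (B := 2 * (2 * σ 0 ^ 2 + 2 * (K : ℝ) ^ 2)) (fun y => by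
        have := mul_deriv_mul_growth hσ y 1
        rw [mul_one] at this
        refine this.trans ?_
        nlinarith [mul_nonneg (sq_nonneg (K : ℝ)) (sq_nonneg y),
          mul_nonneg (sq_nonneg (σ 0)) (sq_nonneg y)]) _
  have i4 : Integrable (fun x => deriv σ x ^ 2) μ :=
    integrable_gaussianReal_of_abs_le (by fun_prop)
      (B := 2 * (2 * σ 0 ^ 2 + 2 * (K : ℝ) ^ 2)) (fun y => by
        have := deriv_mul_sq_growth hσ y 1
        rw [mul_one] at this
        refine this.trans ?_
        nlinarith [mul_nonneg (sq_nonneg (K : ℝ)) (sq_nonneg y),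
          mul_nonneg (sq_nonneg (σ 0)) (sq_nonneg y)]) _
  have i5 : Integrable (fun x => deriv σ x * (deriv σ x * x)) μ :=
    integrable_gaussianReal_of_abs_le (by fun_prop)
      (B := (K : ℝ) ^ 2) (fun y => by
        have h1 : |deriv σ y * (deriv σ y * y)| = deriv σ y ^ 2 * |y| := by
          rw [← mul_assoc, abs_mul, ← sq, abs_of_nonneg (sq_nonneg _)]
        rw [h1]
        have h2 : |y| ≤ 1 + y ^ 2 := by
          rw [← sq_abs]; nlinarith [sq_nonneg (|y| - 1)]
        exact mul_le_mul (deriv_sq_le hσ y) h2 (abs_nonneg _) (sq_nonneg _)) _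
  have ey : ∫ y, y ∂ν = 0 := by simp [ν]
  have ey2 : ∫ y, y ^ 2 ∂ν = δ := by
    rw [integral_sq_gaussianReal, Real.coe_toNNReal _ hδ]
  refine ⟨?_, ?_, ?_⟩
  · simp only [layerMoment, Matrix.of_apply, Matrix.cons_val', Matrix.cons_val_zero,
      Matrix.cons_val_fin_one]
    rw [hmap _ (by fun_prop)]
    simpa using integral_prod_mul (μ := μ) (ν := ν) (fun x => σ x ^ 2) (fun _ => (1 : ℝ))
  · simp only [layerMoment, Matrix.of_apply, Matrix.cons_val', Matrix.cons_val_zero,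
      Matrix.cons_val_fin_one, Matrix.cons_val_one]
    rw [hmap _ (by fun_prop)]
    have e : ∀ p : ℝ × ℝ, σ p.1 * (deriv σ p.1 * (ρ * p.1 + p.2)) =
        ρ * (σ p.1 * (deriv σ p.1 * p.1)) * 1 + σ p.1 * deriv σ p.1 * p.2 := fun p => by ring
    simp only [Matrix.cons_val_zero, Matrix.cons_val_one, Matrix.cons_val_fin_one, e]
    rw [integral_add ((i1.const_mul ρ).mul_prod (integrable_const 1)) (i3.mul_prod iy),
      integral_prod_mul (fun x => ρ * (σ x * (deriv σ x * x))) (fun _ => (1 : ℝ)),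
      integral_prod_mul (fun x => σ x * deriv σ x) (fun y => y), ey, integral_const_mul]
    simp
  · simp only [layerMoment, Matrix.of_apply, Matrix.cons_val',
      Matrix.cons_val_fin_one, Matrix.cons_val_one]
    rw [hmap _ (by fun_prop)]
    have e : ∀ p : ℝ × ℝ, (deriv σ p.1 * (ρ * p.1 + p.2)) ^ 2 =
        ρ ^ 2 * (deriv σ p.1 * p.1) ^ 2 * 1 +
          2 * ρ * (deriv σ p.1 * (deriv σ p.1 * p.1)) * p.2 + deriv σ p.1 ^ 2 * p.2 ^ 2 :=
      fun p => by ring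
    simp only [Matrix.cons_val_zero, Matrix.cons_val_one, Matrix.cons_val_fin_one, e]
    have j1 := (i2.const_mul (ρ ^ 2)).mul_prod (ν := ν) (integrable_const (1 : ℝ))
    have j2 := (i5.const_mul (2 * ρ)).mul_prod iy
    have j12 : Integrable (fun p : ℝ × ℝ => ρ ^ 2 * (deriv σ p.1 * p.1) ^ 2 * 1 +
        2 * ρ * (deriv σ p.1 * (deriv σ p.1 * p.1)) * p.2) (μ.prod ν) := j1.add j2
    rw [integral_add j12 (i4.mul_prod iy2), integral_add j1 j2,
      integral_prod_mul (fun x => ρ ^ 2 * (deriv σ x * x) ^ 2) (fun _ => (1 : ℝ)),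
      integral_prod_mul (fun x => 2 * ρ * (deriv σ x * (deriv σ x * x))) (fun y => y),
      integral_prod_mul (fun x => deriv σ x ^ 2) (fun y => y ^ 2), ey, ey2, integral_const_mul]
    simp [mul_comm]

/-- At `S 0 0 = 0` the recursion sees only `deriv σ 0`, while a small positive variance would see
values of `deriv σ` near `0`, possibly quite different. The hypothesis `S 0 0 = 0 → M 0 0 = 0`
excludes such perturbations. -/
theorem layerMoment_continuousWithin {S : Matrix (Fin 2) (Fin 2) ℝ} (hS : S.PosSemidef) {ε : ℝ}
    (hε : 0 < ε) : ∃ δ > 0, ∀ M : Matrix (Fin 2) (Fin 2) ℝ, M.PosSemidef →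
      (S 0 0 = 0 → M 0 0 = 0) → (∀ i j, |M i j - S i j| < δ) →
      ∀ i j, |layerMoment σ M i j - layerMoment σ S i j| < ε := by
  obtain ⟨h00, -, -, hdet⟩ := hS.fin_two
  have hσm := hσ.continuous.measurable
  have hdm := measurable_deriv σ
  suffices h : ∃ δ > 0, ∀ M : Matrix (Fin 2) (Fin 2) ℝ, M.PosSemidef →
      (S 0 0 = 0 → M 0 0 = 0) → (∀ i j, |M i j - S i j| < δ) →
      |layerMoment σ M 0 0 - layerMoment σ S 0 0| < ε ∧
      |layerMoment σ M 0 1 - layerMoment σ S 0 1| < ε ∧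
      |layerMoment σ M 1 1 - layerMoment σ S 1 1| < ε by
    obtain ⟨δ, hδ, h⟩ := h
    refine ⟨δ, hδ, fun M hM hM0 hMS i j => ?_⟩
    obtain ⟨h1, h2, h3⟩ := h M hM hM0 hMS
    fin_cases i <;> fin_cases j
    · exact h1
    · exact h2
    · exact h2
    · exact h3
  obtain ⟨s1, s2, s3⟩ := layerMoment_eq hσ hS
  rcases h00.eq_or_lt with h | h
  · refine ⟨ε / (deriv σ 0 ^ 2 + 1), by positivity, fun M hM hM0 hMS => ?_⟩
    obtain ⟨m1, m2, m3⟩ := layerMoment_eq hσ hM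
    rw [s1, s2, s3, m1, m2, m3]
    simp only [← h, hM0 h.symm, div_zero, Real.toNNReal_zero, zero_mul, sub_self, abs_zero, hε,
      gaussianReal_zero_var, integral_dirac, sub_zero, ne_eq, OfNat.ofNat_ne_zero,
      not_false_eq_true, zero_pow, zero_add, true_and]
    rw [← sub_mul, abs_mul, abs_of_nonneg (sq_nonneg (deriv σ 0))]
    have := hMS 1 1
    rw [lt_div_iff₀ (by positivity)] at this
    nlinarith [abs_nonneg (M 1 1 - S 1 1)]
  · have g : ∀ φ : ℝ → ℝ, Measurable φ → (∃ B, ∀ y, |φ y| ≤ B * (1 + y ^ 2)) →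
        ContinuousAt (fun t : ℝ × ℝ × ℝ => ∫ y, φ y ∂gaussianReal 0 t.1.toNNReal)
          (S 0 0, S 0 1, S 1 1) := fun φ hφ ⟨B, hB⟩ =>
      ContinuousAt.comp (g := fun v : ℝ => ∫ y, φ y ∂gaussianReal 0 v.toNNReal) (f := Prod.fst)
        (continuousAt_integral_gaussianReal hφ hB h) continuousAt_fst
    have g1 := g (fun y => σ y ^ 2) (by fun_prop) ⟨2 * σ 0 ^ 2 + 2 * (K : ℝ) ^ 2, fun y => by
      simpa using sq_growth hσ y 0⟩
    have g2 := g (fun y => σ y * (deriv σ y * y)) (by fun_prop)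
      ⟨2 * (2 * σ 0 ^ 2 + 2 * (K : ℝ) ^ 2), fun y => (mul_deriv_mul_growth hσ y y).trans (by
        nlinarith [sq_nonneg (K : ℝ), sq_nonneg (σ 0)])⟩
    have g3 := g (fun y => (deriv σ y * y) ^ 2) (by fun_prop)
      ⟨2 * (2 * σ 0 ^ 2 + 2 * (K : ℝ) ^ 2), fun y => (deriv_mul_sq_growth hσ y y).trans (by
        nlinarith [sq_nonneg (K : ℝ), sq_nonneg (σ 0)])⟩
    have g4 := g (fun y => deriv σ y ^ 2) (by fun_prop) ⟨(K : ℝ) ^ 2, fun y => by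
      rw [abs_of_nonneg (sq_nonneg _)]
      nlinarith [deriv_sq_le hσ y, mul_nonneg (sq_nonneg (K : ℝ)) (sq_nonneg y)]⟩
    have c1 : ContinuousAt (fun t : ℝ × ℝ × ℝ => t.2.1 / t.1) (S 0 0, S 0 1, S 1 1) :=
      ContinuousAt.div (by fun_prop) (by fun_prop) h.ne'
    have c2 : ContinuousAt (fun t : ℝ × ℝ × ℝ => t.2.1 ^ 2 / t.1) (S 0 0, S 0 1, S 1 1) :=
      ContinuousAt.div (by fun_prop) (by fun_prop) h.ne'
    have c3 : ContinuousAt (fun t : ℝ × ℝ × ℝ => t.2.2) (S 0 0, S 0 1, S 1 1) := by fun_prop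
    have f1 := Metric.continuousAt_iff.1 g1 ε hε
    have f2 := Metric.continuousAt_iff.1 (c1.mul g2) ε hε
    have f3 := Metric.continuousAt_iff.1 (((c1.pow 2).mul g3).add ((c3.sub c2).mul g4)) ε hε
    obtain ⟨δ₁, hδ₁, f1⟩ := f1
    obtain ⟨δ₂, hδ₂, f2⟩ := f2
    obtain ⟨δ₃, hδ₃, f3⟩ := f3
    refine ⟨min δ₁ (min δ₂ δ₃), by positivity, fun M hM _ hMS => ?_⟩
    obtain ⟨m1, m2, m3⟩ := layerMoment_eq hσ hM
    have hd : dist (M 0 0, M 0 1, M 1 1) (S 0 0, S 0 1, S 1 1) < min δ₁ (min δ₂ δ₃) := by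
      simp only [Prod.dist_eq, Real.dist_eq]
      exact max_lt (hMS 0 0) (max_lt (hMS 0 1) (hMS 1 1))
    rw [s1, s2, s3, m1, m2, m3]
    exact ⟨f1 (hd.trans_le (min_le_left _ _)),
      f2 (hd.trans_le ((min_le_right _ _).trans (min_le_left _ _))),
      f3 (hd.trans_le ((min_le_right _ _).trans (min_le_right _ _)))⟩

end Growth

/-! ### Law of large numbers for one layer -/

/-- The fourth moment of a standard Gaussian. -/
noncomputable def gaussianFourthMoment : ℝ := ∫ y, y ^ 4 ∂gaussianReal 0 1

theorem gaussianFourthMoment_nonneg : 0 ≤ gaussianFourthMoment :=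
  integral_nonneg fun y => by positivity

theorem integrable_pow_four_gaussianReal (v : NNReal) :
    Integrable (fun y : ℝ => y ^ 4) (gaussianReal 0 v) := by
  have := (memLp_id_gaussianReal (μ := 0) (v := v) 4).integrable_norm_pow (by norm_num)
  refine this.congr (Eventually.of_forall fun y => ?_)
  simp only [id, Real.norm_eq_abs]
  exact Even.pow_abs (by decide) y

theorem integral_pow_four_gaussianReal (v : NNReal) :
    ∫ y : ℝ, y ^ 4 ∂gaussianReal 0 v = gaussianFourthMoment * (v : ℝ) ^ 2 := by
  have h : gaussianReal 0 v = (gaussianReal 0 1).map (fun y => Real.sqrt v * y) := by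
    rw [gaussianReal_map_const_mul]
    congr 1
    · simp
    · ext
      simp
  rw [h, integral_map (by fun_prop) (by fun_prop)]
  have h4 : Real.sqrt v ^ 4 = (v : ℝ) ^ 2 := by
    rw [show 4 = 2 * 2 from rfl, pow_mul, Real.sq_sqrt (NNReal.coe_nonneg v)]
  simp_rw [mul_pow, h4]
  rw [integral_const_mul, gaussianFourthMoment, mul_comm]

theorem pairLaw_marginal {S : Matrix (Fin 2) (Fin 2) ℝ} (hS : S.PosSemidef) (i : Fin 2) :
    MeasurePreserving (fun p => p i) (pairLaw S) (gaussianReal 0 (S i i).toNNReal) :=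
  measurePreserving_eval_multivariateGaussian hS

theorem integrable_pairLaw_pow_four {S : Matrix (Fin 2) (Fin 2) ℝ} (hS : S.PosSemidef) (i : Fin 2) :
    Integrable (fun p => p i ^ 4) (pairLaw S) :=
  ((pairLaw_marginal hS i).integrable_comp
    (g := fun y : ℝ => y ^ 4) (by fun_prop)).2 (integrable_pow_four_gaussianReal _)

theorem integral_pairLaw_pow_four {S : Matrix (Fin 2) (Fin 2) ℝ} (hS : S.PosSemidef) (i : Fin 2) :
    ∫ p, p i ^ 4 ∂pairLaw S = gaussianFourthMoment * S i i ^ 2 := by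
  have h := integral_pow_four_gaussianReal (S i i).toNNReal
  rw [← (pairLaw_marginal hS i).map_eq, integral_map (by fun_prop) (by fun_prop),
    Real.coe_toNNReal _ hS.diag_nonneg] at h
  exact h

section Quadratic

variable {F : EuclideanSpace ℝ (Fin 2) → ℝ} (hF : Measurable F) {B : ℝ}
  (hB : ∀ p, |F p| ≤ B * (1 + p 0 ^ 2 + p 1 ^ 2))
  {S : Matrix (Fin 2) (Fin 2) ℝ} (hS : S.PosSemidef)
include hB

theorem sq_le_of_quadratic_growth (p : EuclideanSpace ℝ (Fin 2)) :
    F p ^ 2 ≤ 3 * B ^ 2 * (1 + p 0 ^ 4 + p 1 ^ 4) := by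
  have h := pow_le_pow_left₀ (abs_nonneg _) (hB p) 2
  rw [sq_abs, mul_pow] at h
  have h2 : (1 + p 0 ^ 2 + p 1 ^ 2) ^ 2 ≤ 3 * (1 + p 0 ^ 4 + p 1 ^ 4) := by
    nlinarith [sq_nonneg (p 0 ^ 2 - 1), sq_nonneg (p 1 ^ 2 - 1), sq_nonneg (p 0 ^ 2 - p 1 ^ 2)]
  nlinarith [mul_le_mul_of_nonneg_left h2 (sq_nonneg B)]

include hF hS

theorem memLp_two_pairLaw : MemLp F 2 (pairLaw S) := by
  rw [memLp_two_iff_integrable_sq hF.aestronglyMeasurable]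
  have : IsProbabilityMeasure (pairLaw S) := by unfold pairLaw; infer_instance
  refine Integrable.mono' (g := fun p => 3 * B ^ 2 * (1 + p 0 ^ 4 + p 1 ^ 4)) ?_
    (by fun_prop) (Eventually.of_forall fun p => ?_)
  · exact (((integrable_const 1).add (integrable_pairLaw_pow_four hS 0)).add
      (integrable_pairLaw_pow_four hS 1)).const_mul _
  · rw [Real.norm_of_nonneg (sq_nonneg _)]
    exact sq_le_of_quadratic_growth hB p

theorem integral_sq_pairLaw_le : ∫ p, F p ^ 2 ∂pairLaw S ≤
    3 * B ^ 2 * (1 + gaussianFourthMoment * (S 0 0 ^ 2 + S 1 1 ^ 2)) := by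
  have : IsProbabilityMeasure (pairLaw S) := by unfold pairLaw; infer_instance
  have i0 := integrable_pairLaw_pow_four hS 0
  have i1 := integrable_pairLaw_pow_four hS 1
  have i01 : Integrable (fun p : EuclideanSpace ℝ (Fin 2) => 1 + p 0 ^ 4) (pairLaw S) :=
    (integrable_const 1).add i0
  refine (integral_mono (memLp_two_pairLaw hF hB hS).integrable_sq ((i01.add i1).const_mul _)
    (sq_le_of_quadratic_growth hB)).trans_eq ?_
  rw [integral_const_mul]
  simp only [Pi.add_apply]
  rw [integral_add i01 i1, integral_add (integrable_const 1) i0, integral_pairLaw_pow_four hS,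
    integral_pairLaw_pow_four hS]
  simp
  left
  ring

omit hS in
-- Chebyshev's inequality for `k` independent rows. The variance of one term is at most its second
-- moment, which quadratic growth of `F` bounds through Gaussian fourth moments.
theorem measure_abs_mean_sub_le {m k : ℕ} (hk : 0 < k) (α v : Fin m → ℝ) {ε : ℝ} (hε : 0 < ε) :
    (Measure.pi fun _ : Fin k => Measure.pi fun _ : Fin m => gaussianReal 0 1)
      {U | ε ≤ |(∑ i, F !₂[1 / Real.sqrt m * (U i ⬝ᵥ α), 1 / Real.sqrt m * (U i ⬝ᵥ v)]) / k -
        ∫ p, F p ∂pairLaw (gramAvg α v)|} ≤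
      ENNReal.ofReal (3 * B ^ 2 * (1 + gaussianFourthMoment *
        (gramAvg α v 0 0 ^ 2 + gramAvg α v 1 1 ^ 2)) / (k * ε ^ 2)) := by
  set γ : Measure (Fin m → ℝ) := Measure.pi fun _ : Fin m => gaussianReal 0 1 with hγ
  set r : (Fin m → ℝ) → EuclideanSpace ℝ (Fin 2) :=
    fun u => !₂[1 / Real.sqrt m * (u ⬝ᵥ α), 1 / Real.sqrt m * (u ⬝ᵥ v)] with hr
  have hrm : Measurable r := by
    refine (WithLp.measurable_toLp 2 (Fin 2 → ℝ)).comp (measurable_pi_lambda _ fun i => ?_)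
    fin_cases i <;> simp [dotProduct] <;> fun_prop
  have hmp : MeasurePreserving r γ (pairLaw (gramAvg α v)) := ⟨hrm, map_dotProduct_pair α v⟩
  have hG := posSemidef_gramAvg α v
  have hL : MemLp (F ∘ r) 2 γ := (memLp_two_pairLaw hF hB hG).comp_measurePreserving hmp
  have hint : ∫ u, F (r u) ∂γ = ∫ p, F p ∂pairLaw (gramAvg α v) := by
    rw [← hmp.map_eq, integral_map hrm.aemeasurable hF.aestronglyMeasurable]
  have hint2 : ∫ u, F (r u) ^ 2 ∂γ = ∫ p, F p ^ 2 ∂pairLaw (gramAvg α v) := by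
    rw [← hmp.map_eq, integral_map hrm.aemeasurable (by fun_prop)]
  set X : (Fin k → Fin m → ℝ) → ℝ := ∑ i, fun U => (F ∘ r) (U i) with hX
  have hLi : ∀ i : Fin k, MemLp (fun U : Fin k → Fin m → ℝ => (F ∘ r) (U i)) 2
      (Measure.pi fun _ : Fin k => γ) := fun i =>
    hL.comp_measurePreserving (measurePreserving_eval (fun _ : Fin k => γ) i)
  have hXL : MemLp X 2 (Measure.pi fun _ : Fin k => γ) := by
    rw [hX]
    exact memLp_finsetSum' _ fun i _ => hLi i
  have hvar : Var[X; Measure.pi fun _ : Fin k => γ] ≤ k * (3 * B ^ 2 * (1 + gaussianFourthMoment *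
        (gramAvg α v 0 0 ^ 2 + gramAvg α v 1 1 ^ 2))) := by
    rw [hX, variance_sum_pi (fun _ => hL)]
    simp only [Finset.sum_const, Finset.card_univ, Fintype.card_fin, nsmul_eq_mul]
    gcongr
    refine (variance_le_expectation_sq hL.aestronglyMeasurable).trans ?_
    refine le_trans (le_of_eq ?_) (integral_sq_pairLaw_le hF hB hG)
    exact hint2
  have hmean : ∫ U, X U ∂(Measure.pi fun _ : Fin k => γ) =
      k * ∫ p, F p ∂pairLaw (gramAvg α v) := by
    simp only [hX, Finset.sum_apply]
    rw [integral_finsetSum _ fun i _ => (hLi i).integrable (by norm_num)]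
    have : ∀ i : Fin k, ∫ U, (F ∘ r) (U i) ∂(Measure.pi fun _ : Fin k => γ) =
        ∫ p, F p ∂pairLaw (gramAvg α v) := fun i => by
      rw [← hint]
      have := integral_map (μ := Measure.pi fun _ : Fin k => γ) (φ := fun U => U i)
        (measurable_pi_apply i).aemeasurable (f := fun u => F (r u))
        (hF.comp hrm).aestronglyMeasurable
      rw [(measurePreserving_eval (fun _ : Fin k => γ) i).map_eq] at this
      exact this.symm
    rw [Finset.sum_congr rfl fun i _ => this i]
    simp
  have hk' : (0 : ℝ) < k := Nat.cast_pos.2 hk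
  refine (measure_mono ?_).trans ((meas_ge_le_variance_div_sq hXL (c := k * ε)
    (by positivity)).trans (ENNReal.ofReal_le_ofReal ?_))
  · intro U hU
    simp only [Set.mem_ofPred_eq, hmean] at hU ⊢
    have e : X U - k * ∫ p, F p ∂pairLaw (gramAvg α v) =
        k * ((∑ i, F (r (U i))) / k - ∫ p, F p ∂pairLaw (gramAvg α v)) := by
      simp only [hX, Finset.sum_apply, Function.comp]
      field_simp
    rw [e, abs_mul, abs_of_pos hk']
    exact mul_le_mul_of_nonneg_left hU hk'.le
  · rw [div_le_div_iff₀ (by positivity) (by positivity)]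
    have := mul_le_mul_of_nonneg_right hvar (show 0 ≤ (k : ℝ) * ε ^ 2 by positivity)
    refine this.trans_eq ?_
    ring

end Quadratic

/-! ### Positivity and degenerate cases of the recursion -/

theorem posSemidef_layerMoment {σ : ℝ → ℝ} {K : NNReal} (hσ : LipschitzWith K σ)
    {S : Matrix (Fin 2) (Fin 2) ℝ} (hS : S.PosSemidef) : (layerMoment σ S).PosSemidef := by
  have hσm := hσ.continuous.measurable
  have hdm := measurable_deriv σ
  have l1 : Integrable (fun p => σ (p 0) ^ 2) (pairLaw S) := by
    have : IsProbabilityMeasure (pairLaw S) := by unfold pairLaw; infer_instance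
    exact (memLp_two_pairLaw (by fun_prop) (fun p => sq_growth hσ (p 0) (p 1)) hS).integrable
      (by norm_num)
  have l2 : Integrable (fun p => σ (p 0) * (deriv σ (p 0) * p 1)) (pairLaw S) := by
    have : IsProbabilityMeasure (pairLaw S) := by unfold pairLaw; infer_instance
    exact (memLp_two_pairLaw (by fun_prop) (fun p => mul_deriv_mul_growth hσ (p 0) (p 1))
      hS).integrable (by norm_num)
  have l3 : Integrable (fun p => (deriv σ (p 0) * p 1) ^ 2) (pairLaw S) := by
    have : IsProbabilityMeasure (pairLaw S) := by unfold pairLaw; infer_instance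
    exact (memLp_two_pairLaw (by fun_prop) (fun p => deriv_mul_sq_growth hσ (p 0) (p 1))
      hS).integrable (by norm_num)
  refine posSemidef_fin_two fun x y => ?_
  have h : 0 ≤ ∫ p, (x * σ (p 0) + y * (deriv σ (p 0) * p 1)) ^ 2 ∂pairLaw S :=
    integral_nonneg fun _ => sq_nonneg _
  have e : ∀ p : EuclideanSpace ℝ (Fin 2), (x * σ (p 0) + y * (deriv σ (p 0) * p 1)) ^ 2 =
      x ^ 2 * σ (p 0) ^ 2 + 2 * (x * y) * (σ (p 0) * (deriv σ (p 0) * p 1)) +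
        y ^ 2 * (deriv σ (p 0) * p 1) ^ 2 := fun p => by ring
  simp only [e] at h
  have l12 : Integrable (fun p => x ^ 2 * σ (p 0) ^ 2 +
      2 * (x * y) * (σ (p 0) * (deriv σ (p 0) * p 1))) (pairLaw S) :=
    (l1.const_mul _).add (l2.const_mul _)
  rw [integral_add l12 (l3.const_mul _), integral_add (l1.const_mul _) (l2.const_mul _),
    integral_const_mul, integral_const_mul, integral_const_mul] at h
  linarith

theorem posSemidef_momentMatrix {σ : ℝ → ℝ} {K : NNReal} (hσ : LipschitzWith K σ) {n₀ : ℕ}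
    (x z : EuclideanSpace ℝ (Fin n₀)) (ℓ : ℕ) : (momentMatrix σ x z ℓ).PosSemidef := by
  induction ℓ with
  | zero =>
    have h : momentMatrix σ x z 0 = gramAvg (fun i => x i) (fun i => z i) := by
      simp only [momentMatrix, gramAvg, EuclideanSpace.real_norm_sq_eq, PiLp.inner_apply,
        dotProduct, ← sq]
      simp [mul_comm]
    rw [h]
    exact posSemidef_gramAvg _ _
  | succ ℓ ih => exact posSemidef_layerMoment hσ ih

section Degenerate

variable {σ : ℝ → ℝ} {K : NNReal} (hσ : LipschitzWith K σ)
include hσ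

/-- A Lipschitz function is the integral of its derivative, so here `σ` is constant. This upgrades
almost everywhere information to every point, as statements about all weights require. -/
theorem deriv_eq_zero_of_ae (h : deriv σ =ᵐ[volume] 0) (y : ℝ) : deriv σ y = 0 := by
  have hc : ∀ t, σ t = σ 0 := fun t => by
    have := (hσ.lipschitzOnWith (s := Set.uIcc 0 t)).absolutelyContinuousOnInterval.integral_deriv_eq_sub
    rw [intervalIntegral.integral_congr_ae (g := fun _ => (0 : ℝ))
      (h.mono fun s hs _ => hs)] at this
    exact (sub_eq_zero.1 (by simpa using this.symm))
  rw [funext hc]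
  simp

theorem layerMoment_zero_zero_eq_zero {S : Matrix (Fin 2) (Fin 2) ℝ} (hS : S.PosSemidef)
    (h : layerMoment σ S 0 0 = 0) : (S 0 0 = 0 ∧ σ 0 = 0) ∨ ∀ y, σ y = 0 := by
  rw [(layerMoment_eq hσ hS).1] at h
  have h00 : 0 ≤ S 0 0 := hS.diag_nonneg
  rcases h00.eq_or_lt with h0 | h0
  · left
    simpa [← h0] using h
  · right
    rw [integral_eq_zero_iff_of_nonneg (fun y => sq_nonneg _)
      (integrable_gaussianReal_of_abs_le (hσ.continuous.measurable.pow_const 2)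
        (fun y => by simpa using sq_growth hσ y 0) _)] at h
    have hv := (gaussianReal_absolutelyContinuous' 0 (Real.toNNReal_pos.2 h0).ne').ae_eq h
    have := (Continuous.ae_eq_iff_eq volume (hσ.continuous.pow 2)
      continuous_const).1 hv
    intro y
    exact pow_eq_zero_iff two_ne_zero |>.1 (congrFun this y)

theorem layerMoment_one_one_eq_zero {S : Matrix (Fin 2) (Fin 2) ℝ} (hS : S.PosSemidef)
    (h : layerMoment σ S 1 1 = 0) :
    S 1 1 = 0 ∨ (S 0 0 = 0 ∧ deriv σ 0 = 0) ∨ ∀ y, deriv σ y = 0 := by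
  rw [(layerMoment_eq hσ hS).2.2] at h
  obtain ⟨h00, h11, -, hdet⟩ := hS.fin_two
  have hσm := hσ.continuous.measurable
  have hdm := measurable_deriv σ
  rcases h00.eq_or_lt with h0 | h0
  · simp only [← h0, Real.toNNReal_zero, gaussianReal_zero_var, integral_dirac, div_zero, ne_eq,
      OfNat.ofNat_ne_zero, not_false_eq_true, zero_pow, zero_mul, zero_add, sub_zero,
      mul_eq_zero, pow_eq_zero_iff] at h
    tauto
  · by_cases h1 : S 1 1 = 0
    · exact Or.inl h1
    refine Or.inr (Or.inr ?_)
    have hac := gaussianReal_absolutelyContinuous' 0 (Real.toNNReal_pos.2 h0).ne'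
    have hδ : 0 ≤ S 1 1 - S 0 1 ^ 2 / S 0 0 := by
      rw [sub_nonneg, div_le_iff₀ h0]
      linarith
    have n1 : 0 ≤ ∫ y, (deriv σ y * y) ^ 2 ∂gaussianReal 0 (S 0 0).toNNReal :=
      integral_nonneg fun _ => sq_nonneg _
    have n2 : 0 ≤ ∫ y, deriv σ y ^ 2 ∂gaussianReal 0 (S 0 0).toNNReal :=
      integral_nonneg fun _ => sq_nonneg _
    rw [add_eq_zero_iff_of_nonneg (by positivity) (by positivity)] at h
    obtain ⟨e1, e2⟩ := h
    apply deriv_eq_zero_of_ae hσ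
    -- If `S 0 1 = 0`, the Schur complement is `S 1 1 ≠ 0` and the second integral must vanish;
    -- otherwise the first must.
    by_cases hρ : S 0 1 = 0
    · have e3 : ∫ y, deriv σ y ^ 2 ∂gaussianReal 0 (S 0 0).toNNReal = 0 := by
        simpa [hρ, h1] using e2
      rw [integral_eq_zero_iff_of_nonneg (fun y => sq_nonneg _)
        (integrable_gaussianReal_of_abs_le (hdm.pow_const 2) (B := (K : ℝ) ^ 2) (fun y => by
          rw [abs_of_nonneg (sq_nonneg _)]
          nlinarith [deriv_sq_le hσ y, mul_nonneg (sq_nonneg (K : ℝ)) (sq_nonneg y)]) _)] at e3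
      filter_upwards [hac.ae_eq e3] with y hy
      simpa using hy
    · have e3 : ∫ y, (deriv σ y * y) ^ 2 ∂gaussianReal 0 (S 0 0).toNNReal = 0 := by
        simpa [hρ, h0.ne'] using e1
      rw [integral_eq_zero_iff_of_nonneg (fun y => sq_nonneg _)
        (integrable_gaussianReal_of_abs_le (by fun_prop)
          (B := 2 * (2 * σ 0 ^ 2 + 2 * (K : ℝ) ^ 2))
          (fun y => (deriv_mul_sq_growth hσ y y).trans (by
            nlinarith [sq_nonneg (K : ℝ), sq_nonneg (σ 0)])) _)] at e3
      filter_upwards [hac.ae_eq e3, Measure.ae_ne volume (0 : ℝ)] with y hy hy0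
      simpa [hy0] using hy

end Degenerate

/-! ### Tangent vectors of the finite network -/

section Network

variable {n₀ H : ℕ} {w : Fin H → ℕ}

/-- The derivative of the activation of layer `ℓ` in the input direction `z`. -/
noncomputable def tangent (σ : ℝ → ℝ) (W : Weights n₀ w) (x z : EuclideanSpace ℝ (Fin n₀))
    (ℓ : ℕ) (hℓ : ℓ < H + 1) : Fin (layerWidth n₀ w ℓ) → ℝ :=
  activationJacobian σ W x ℓ hℓ *ᵥ (fun i => z i)

theorem scaledWeight_mulVec (W : Weights n₀ w) (ℓ : ℕ) (hℓ : ℓ < H + 1)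
    (α : Fin (layerWidth n₀ w ℓ) → ℝ) (i : Fin (layerWidth n₀ w (ℓ + 1))) :
    (scaledWeight W ℓ hℓ *ᵥ α) i =
      1 / Real.sqrt (layerWidth n₀ w ℓ : ℝ) * (W ⟨ℓ, hℓ⟩ i ⬝ᵥ α) := by
  simp only [scaledWeight, Matrix.smul_mulVec, Pi.smul_apply, smul_eq_mul]
  rfl

variable (σ : ℝ → ℝ) (W : Weights n₀ w) (x z : EuclideanSpace ℝ (Fin n₀))

theorem activation_succ (ℓ : ℕ) (hℓ : ℓ + 1 < H + 1) (i : Fin (layerWidth n₀ w (ℓ + 1))) :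
    activation σ W x (ℓ + 1) hℓ i = σ (1 / Real.sqrt (layerWidth n₀ w ℓ : ℝ) *
      (W ⟨ℓ, Nat.lt_of_succ_lt hℓ⟩ i ⬝ᵥ activation σ W x ℓ (Nat.lt_of_succ_lt hℓ))) := by
  rw [← scaledWeight_mulVec]
  rfl

theorem tangent_zero (h : 0 < H + 1) : tangent σ W x z 0 h = fun i => z i := by
  simp only [tangent, activationJacobian]
  exact Matrix.one_mulVec _

theorem tangent_succ (ℓ : ℕ) (hℓ : ℓ + 1 < H + 1) (i : Fin (layerWidth n₀ w (ℓ + 1))) :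
    tangent σ W x z (ℓ + 1) hℓ i = deriv σ (1 / Real.sqrt (layerWidth n₀ w ℓ : ℝ) *
      (W ⟨ℓ, Nat.lt_of_succ_lt hℓ⟩ i ⬝ᵥ activation σ W x ℓ (Nat.lt_of_succ_lt hℓ))) *
      (1 / Real.sqrt (layerWidth n₀ w ℓ : ℝ) *
        (W ⟨ℓ, Nat.lt_of_succ_lt hℓ⟩ i ⬝ᵥ tangent σ W x z ℓ (Nat.lt_of_succ_lt hℓ))) := by
  rw [← scaledWeight_mulVec, ← scaledWeight_mulVec]
  simp only [tangent, activationJacobian]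
  rw [← Matrix.mulVec_mulVec, Matrix.mulVec_diagonal, ← Matrix.mulVec_mulVec]
  rfl

theorem jacobian_mulVec (i : Fin (layerWidth n₀ w (H + 1))) :
    (jacobian σ W x *ᵥ (fun j => z j)) i = 1 / Real.sqrt (layerWidth n₀ w H : ℝ) *
      (W ⟨H, Nat.lt_succ_self H⟩ i ⬝ᵥ tangent σ W x z H (Nat.lt_succ_self H)) := by
  rw [← scaledWeight_mulVec, jacobian, ← Matrix.mulVec_mulVec]
  rfl

variable {σ} {K : NNReal} (hσ : LipschitzWith K σ) (hn₀ : 0 < n₀)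
include hσ hn₀

/-- This holds for every choice of weights, and supplies the degenerate-case hypothesis in the
continuity of `layerMoment`. -/
theorem activation_eq_zero (ℓ : ℕ) (hℓ : ℓ < H + 1) (h : momentMatrix σ x z ℓ 0 0 = 0) :
    activation σ W x ℓ hℓ = 0 := by
  induction ℓ with
  | zero =>
    have hx : x = 0 := by simpa [momentMatrix, hn₀.ne'] using h
    funext i
    simp only [activation, hx]
    rfl
  | succ ℓ ih =>
    rw [momentMatrix_succ] at h
    funext i
    rw [activation_succ]
    rcases layerMoment_zero_zero_eq_zero hσ (posSemidef_momentMatrix hσ x z ℓ) h with ⟨h1, h2⟩ | h1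
    · rw [ih (Nat.lt_of_succ_lt hℓ) h1]
      simp [h2]
    · exact h1 _

theorem tangent_eq_zero (ℓ : ℕ) (hℓ : ℓ < H + 1) (h : momentMatrix σ x z ℓ 1 1 = 0) :
    tangent σ W x z ℓ hℓ = 0 := by
  induction ℓ with
  | zero =>
    have hz : z = 0 := by simpa [momentMatrix, hn₀.ne'] using h
    rw [tangent_zero]
    funext i
    simp only [hz]
    rfl
  | succ ℓ ih =>
    rw [momentMatrix_succ] at h
    funext i
    rw [tangent_succ]
    rcases layerMoment_one_one_eq_zero hσ (posSemidef_momentMatrix hσ x z ℓ) h with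
      h1 | ⟨h1, h2⟩ | h1
    · rw [ih (Nat.lt_of_succ_lt hℓ) h1]
      simp
    · rw [activation_eq_zero W x z hσ hn₀ ℓ (Nat.lt_of_succ_lt hℓ) h1]
      simp [h2]
    · simp [h1]

end Network

/-! ### Convergence of the Gram matrices as the widths grow -/

/-- Fubini's theorem, used as conditioning on every weight matrix but one. -/
theorem measure_pi_le_of_update {ι : Type*} [Fintype ι] [DecidableEq ι] {X : ι → Type*}
    [∀ i, MeasurableSpace (X i)] (μ : ∀ i, Measure (X i)) [∀ i, IsProbabilityMeasure (μ i)]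
    {E : Set (∀ i, X i)} (hE : MeasurableSet E) (i : ι) {δ : ENNReal}
    (h : ∀ x, μ i {u | Function.update x i u ∈ E} ≤ δ) : Measure.pi μ E ≤ δ := by
  have key := lintegral_le_of_lmarginal_le (μ := μ) {i} (f := E.indicator fun _ => 1)
    (g := fun _ => δ) (measurable_const.indicator hE) measurable_const (fun x => ?_)
  · rw [lintegral_indicator_const hE] at key
    simpa using key
  · rw [lmarginal_singleton, lmarginal_singleton]
    simp only [lintegral_const, measure_univ, mul_one]
    have hm : MeasurableSet {u | Function.update x i u ∈ E} := measurable_update x hE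
    have e : ∀ u, E.indicator (fun _ => (1 : ENNReal)) (Function.update x i u) =
        {u | Function.update x i u ∈ E}.indicator (fun _ => 1) u := fun u => rfl
    simp_rw [e]
    rw [lintegral_indicator_const hm, one_mul]
    exact h x

/-- Half of `ε` pays for replacing the Gram matrix by `S`, the other half for sampling. It is
essential that `δ` and `C` do not depend on `m`, `k`, `α`, `v`. -/
theorem measure_gramAvg_sub_layerMoment_le {σ : ℝ → ℝ} {K : NNReal} (hσ : LipschitzWith K σ)
    {S : Matrix (Fin 2) (Fin 2) ℝ} (hS : S.PosSemidef) {ε : ℝ} (hε : 0 < ε) :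
    ∃ δ > 0, ∃ C : ℝ, ∀ (m k : ℕ) (α v : Fin m → ℝ), 0 < k → (S 0 0 = 0 → α = 0) →
      (∀ i j, |gramAvg α v i j - S i j| < δ) →
      (Measure.pi fun _ : Fin k => Measure.pi fun _ : Fin m => gaussianReal 0 1)
        {U | ∃ i j, ε ≤ |gramAvg (fun r => σ (1 / Real.sqrt m * (U r ⬝ᵥ α)))
          (fun r => deriv σ (1 / Real.sqrt m * (U r ⬝ᵥ α)) * (1 / Real.sqrt m * (U r ⬝ᵥ v))) i j -
          layerMoment σ S i j|} ≤ ENNReal.ofReal (C / k) := by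
  obtain ⟨δ, hδ, hcont⟩ := layerMoment_continuousWithin hσ hS (half_pos hε)
  have hσm := hσ.continuous.measurable
  have hdm := measurable_deriv σ
  set B := 2 * σ 0 ^ 2 + 2 * (K : ℝ) ^ 2 with hB
  set V := 3 * B ^ 2 * (1 + gaussianFourthMoment * ((S 0 0 + 1) ^ 2 + (S 1 1 + 1) ^ 2)) with hV
  -- The `1` keeps the diagonal of the Gram matrix below `S i i + 1`, so that `V` bounds the
  -- variance; the factor `3` is a union bound over the distinct entries.
  refine ⟨min δ 1, by positivity, 3 * (V / (ε / 2) ^ 2), fun m k α v hk hα hG => ?_⟩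
  have hk' : (0 : ℝ) < k := Nat.cast_pos.2 hk
  have hGS := hcont _ (posSemidef_gramAvg α v) (fun h => by simp [gramAvg, hα h])
    fun i j => (hG i j).trans_le (min_le_left _ _)
  have hV1 : 3 * B ^ 2 * (1 + gaussianFourthMoment *
      (gramAvg α v 0 0 ^ 2 + gramAvg α v 1 1 ^ 2)) ≤ V := by
    have hb : ∀ i, gramAvg α v i i ^ 2 ≤ (S i i + 1) ^ 2 := fun i => by
      have h1 := (abs_lt.1 ((hG i i).trans_le (min_le_right _ _))).2
      exact pow_le_pow_left₀ (posSemidef_gramAvg α v).diag_nonneg (by linarith) 2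
    have hb2 := add_le_add (hb 0) (hb 1)
    have := gaussianFourthMoment_nonneg
    rw [hV]
    exact mul_le_mul_of_nonneg_left (add_le_add le_rfl (mul_le_mul_of_nonneg_left hb2 this))
      (by positivity)
  have key : ∀ F : EuclideanSpace ℝ (Fin 2) → ℝ, Measurable F →
      (∀ p, |F p| ≤ B * (1 + p 0 ^ 2 + p 1 ^ 2)) →
      (Measure.pi fun _ : Fin k => Measure.pi fun _ : Fin m => gaussianReal 0 1)
      {U | ε / 2 ≤ |(∑ i, F !₂[1 / Real.sqrt m * (U i ⬝ᵥ α), 1 / Real.sqrt m * (U i ⬝ᵥ v)]) / k -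
        ∫ p, F p ∂pairLaw (gramAvg α v)|} ≤ ENNReal.ofReal (V / (ε / 2) ^ 2 / k) :=
    fun F hF hFB => (measure_abs_mean_sub_le hF hFB hk α v (half_pos hε)).trans <| by
      apply ENNReal.ofReal_le_ofReal
      rw [div_div, mul_comm ((ε / 2) ^ 2)]
      gcongr
  have k1 := key (fun p => σ (p 0) ^ 2) (by fun_prop) fun p => sq_growth hσ _ _
  have k2 := key (fun p => σ (p 0) * (deriv σ (p 0) * p 1)) (by fun_prop)
    fun p => mul_deriv_mul_growth hσ _ _
  have k3 := key (fun p => (deriv σ (p 0) * p 1) ^ 2) (by fun_prop)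
    fun p => deriv_mul_sq_growth hσ _ _
  have hsum : ENNReal.ofReal (3 * (V / (ε / 2) ^ 2) / k) = ENNReal.ofReal (V / (ε / 2) ^ 2 / k) +
      ENNReal.ofReal (V / (ε / 2) ^ 2 / k) + ENNReal.ofReal (V / (ε / 2) ^ 2 / k) := by
    have h0 : 0 ≤ V / (ε / 2) ^ 2 / k := by
      have := gaussianFourthMoment_nonneg
      positivity
    rw [← ENNReal.ofReal_add h0 h0, ← ENNReal.ofReal_add (add_nonneg h0 h0) h0]
    congr 1
    ring
  rw [hsum]
  refine (measure_mono ?_).trans ((measure_union_le _ _).trans (add_le_add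
    ((measure_union_le _ _).trans (add_le_add k1 k2)) k3))
  rintro U ⟨i, j, hij⟩
  have tri : ∀ a b c : ℝ, |b - c| < ε / 2 → ε ≤ |a - c| → ε / 2 ≤ |a - b| := fun a b c h1 h2 => by
    have := abs_sub_le a b c
    linarith
  have h := tri _ _ _ (hGS i j) hij
  fin_cases i <;> fin_cases j
  · left; left
    simpa [gramAvg, layerMoment, dotProduct, ← sq] using h
  · left; right
    simpa [gramAvg, layerMoment, dotProduct] using h
  · left; right
    simpa [gramAvg, layerMoment, dotProduct] using h
  · right
    simpa [gramAvg, layerMoment, dotProduct, ← sq] using h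

section Convergence

variable {n₀ H : ℕ}

theorem measurable_activation {w : Fin H → ℕ} {σ : ℝ → ℝ} (hσ : Measurable σ)
    (x : EuclideanSpace ℝ (Fin n₀)) (ℓ : ℕ) (hℓ : ℓ < H + 1) :
    Measurable fun W : Weights n₀ w => activation σ W x ℓ hℓ := by
  induction ℓ with
  | zero => exact measurable_const
  | succ ℓ ih =>
    have := ih (Nat.lt_of_succ_lt hℓ)
    refine measurable_pi_lambda _ fun i => ?_
    simp only [activation_succ, dotProduct]
    fun_prop

theorem measurable_tangent {w : Fin H → ℕ} {σ : ℝ → ℝ} (hσ : Measurable σ)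
    (x z : EuclideanSpace ℝ (Fin n₀)) (ℓ : ℕ) (hℓ : ℓ < H + 1) :
    Measurable fun W : Weights n₀ w => tangent σ W x z ℓ hℓ := by
  induction ℓ with
  | zero =>
    simp only [tangent_zero]
    exact measurable_const
  | succ ℓ ih =>
    have h1 := ih (Nat.lt_of_succ_lt hℓ)
    have h2 := measurable_activation (w := w) hσ x ℓ (Nat.lt_of_succ_lt hℓ)
    have h3 := measurable_deriv σ
    refine measurable_pi_lambda _ fun i => ?_
    simp only [tangent_succ, dotProduct]
    fun_prop

theorem measurable_gramAvg {w : Fin H → ℕ} {σ : ℝ → ℝ} (hσ : Measurable σ)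
    (x z : EuclideanSpace ℝ (Fin n₀)) (ℓ : ℕ) (hℓ : ℓ < H + 1) (i j : Fin 2) :
    Measurable fun W : Weights n₀ w =>
      gramAvg (activation σ W x ℓ hℓ) (tangent σ W x z ℓ hℓ) i j := by
  have h1 := measurable_activation (w := w) hσ x ℓ hℓ
  have h2 := measurable_tangent (w := w) hσ x z ℓ hℓ
  fin_cases i <;> fin_cases j <;> simp [gramAvg, dotProduct] <;> fun_prop

theorem activation_update {w : Fin H → ℕ} (σ : ℝ → ℝ) (W : Weights n₀ w)
    (x : EuclideanSpace ℝ (Fin n₀)) (k : Fin (H + 1))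
    (u : Fin (layerWidth n₀ w ((k : ℕ) + 1)) → Fin (layerWidth n₀ w (k : ℕ)) → ℝ)
    (ℓ : ℕ) (hℓ : ℓ < H + 1) (hk : ℓ ≤ k) :
    activation σ (Function.update W k u) x ℓ hℓ = activation σ W x ℓ hℓ := by
  induction ℓ with
  | zero => rfl
  | succ ℓ ih =>
    funext i
    have hne : (⟨ℓ, Nat.lt_of_succ_lt hℓ⟩ : Fin (H + 1)) ≠ k := fun h => by
      rw [← h] at hk
      simp at hk
    rw [activation_succ, activation_succ, ih _ (by omega), Function.update_of_ne hne]

theorem tangent_update {w : Fin H → ℕ} (σ : ℝ → ℝ) (W : Weights n₀ w)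
    (x z : EuclideanSpace ℝ (Fin n₀)) (k : Fin (H + 1))
    (u : Fin (layerWidth n₀ w ((k : ℕ) + 1)) → Fin (layerWidth n₀ w (k : ℕ)) → ℝ)
    (ℓ : ℕ) (hℓ : ℓ < H + 1) (hk : ℓ ≤ k) :
    tangent σ (Function.update W k u) x z ℓ hℓ = tangent σ W x z ℓ hℓ := by
  induction ℓ with
  | zero => rw [tangent_zero, tangent_zero]
  | succ ℓ ih =>
    funext i
    have hne : (⟨ℓ, Nat.lt_of_succ_lt hℓ⟩ : Fin (H + 1)) ≠ k := fun h => by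
      rw [← h] at hk
      simp at hk
    rw [tangent_succ, tangent_succ, ih _ (by omega), Function.update_of_ne hne,
      activation_update σ W x k u ℓ _ (by omega)]

instance isProbabilityMeasure_initLaw (n₀ : ℕ) {H : ℕ} (w : Fin H → ℕ) :
    IsProbabilityMeasure (initLaw n₀ w) := by
  unfold initLaw
  infer_instance

theorem gramAvg_layer_zero {w : Fin H → ℕ} (σ : ℝ → ℝ) (W : Weights n₀ w)
    (x z : EuclideanSpace ℝ (Fin n₀)) (h : 0 < H + 1) :
    gramAvg (activation σ W x 0 h) (tangent σ W x z 0 h) = momentMatrix σ x z 0 := by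
  rw [tangent_zero]
  simp only [momentMatrix, gramAvg, EuclideanSpace.real_norm_sq_eq, PiLp.inner_apply,
    dotProduct, ← sq, activation, layerWidth]
  simp only [mul_comm, Real.ringHom_apply, RCLike.inner_apply]
  rfl

theorem tendsto_layerWidth_succ (n₀ : ℕ) (ℓ : ℕ) (hℓ : ℓ < H) :
    Tendsto (fun w : Fin H → ℕ => layerWidth n₀ w (ℓ + 1)) atTop atTop := by
  simp only [layerWidth, hℓ, dite_true]
  exact tendsto_atTop.2 fun b => (eventually_ge_atTop fun _ => b).mono fun w hw => hw _

theorem tendsto_measure_gramAvg {σ : ℝ → ℝ} {K : NNReal} (hσ : LipschitzWith K σ) (hn₀ : 0 < n₀)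
    (x z : EuclideanSpace ℝ (Fin n₀)) (ℓ : ℕ) (hℓ : ℓ < H + 1) {ε : ℝ} (hε : 0 < ε) :
    Tendsto (fun w : Fin H → ℕ => initLaw n₀ w {W | ∃ i j, ε ≤
      |gramAvg (activation σ W x ℓ hℓ) (tangent σ W x z ℓ hℓ) i j - momentMatrix σ x z ℓ i j|})
      atTop (nhds 0) := by
  induction ℓ generalizing ε with
  | zero =>
    simp [gramAvg_layer_zero, hε.not_ge]
  | succ ℓ ih =>
    have hσm := hσ.continuous.measurable
    have hℓ' := Nat.lt_of_succ_lt hℓ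
    obtain ⟨δ, hδ, C, hC⟩ := measure_gramAvg_sub_layerMoment_le hσ
      (posSemidef_momentMatrix hσ x z ℓ) hε
    have hlim : Tendsto (fun w : Fin H → ℕ => initLaw n₀ w {W | ∃ i j, δ ≤
        |gramAvg (activation σ W x ℓ hℓ') (tangent σ W x z ℓ hℓ') i j -
          momentMatrix σ x z ℓ i j|} + ENNReal.ofReal (C / (layerWidth n₀ w (ℓ + 1) : ℕ)))
        atTop (nhds 0) := by
      have h1 : Tendsto (fun w : Fin H → ℕ => C / ((layerWidth n₀ w (ℓ + 1) : ℕ) : ℝ)) atTop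
          (nhds 0) := tendsto_const_nhds.div_atTop
        (tendsto_natCast_atTop_atTop.comp (tendsto_layerWidth_succ n₀ ℓ (by omega)))
      simpa using (ih hℓ' hδ).add (ENNReal.tendsto_ofReal h1)
    refine tendsto_of_tendsto_of_tendsto_of_le_of_le' tendsto_const_nhds hlim
      (Eventually.of_forall fun _ => zero_le) ?_
    filter_upwards [(tendsto_layerWidth_succ n₀ ℓ (by omega)).eventually_gt_atTop 0] with w hw
    -- The event that layer `ℓ` is close to its limit and yet layer `ℓ + 1` is not. Its probability
    -- is bounded by resampling `W^(ℓ)` alone, which leaves layer `ℓ` unchanged.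
    set E : Set (Weights n₀ w) := {W | (∀ i j, |gramAvg (activation σ W x ℓ hℓ')
      (tangent σ W x z ℓ hℓ') i j - momentMatrix σ x z ℓ i j| < δ) ∧ ∃ i j, ε ≤
      |gramAvg (activation σ W x (ℓ + 1) hℓ) (tangent σ W x z (ℓ + 1) hℓ) i j -
        momentMatrix σ x z (ℓ + 1) i j|} with hE
    have hEm : MeasurableSet E := by
      have h1 := fun i j => measurable_gramAvg (w := w) hσm x z ℓ hℓ' i j
      have h2 := fun i j => measurable_gramAvg (w := w) hσm x z (ℓ + 1) hℓ i j
      have e : E = (⋂ i, ⋂ j, {W | |gramAvg (activation σ W x ℓ hℓ')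
          (tangent σ W x z ℓ hℓ') i j - momentMatrix σ x z ℓ i j| < δ}) ∩ ⋃ i, ⋃ j, {W | ε ≤
          |gramAvg (activation σ W x (ℓ + 1) hℓ) (tangent σ W x z (ℓ + 1) hℓ) i j -
            momentMatrix σ x z (ℓ + 1) i j|} := by
        ext W
        simp only [hE, Set.mem_ofPred_eq, Set.mem_inter_iff, Set.mem_iInter, Set.mem_iUnion]
      rw [e]
      exact (MeasurableSet.iInter fun i => MeasurableSet.iInter fun j =>
        measurableSet_lt ((h1 i j).sub_const _).abs measurable_const).inter
        (MeasurableSet.iUnion fun i => MeasurableSet.iUnion fun j =>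
          measurableSet_le measurable_const ((h2 i j).sub_const _).abs)
    have hEle : initLaw n₀ w E ≤ ENNReal.ofReal (C / (layerWidth n₀ w (ℓ + 1) : ℕ)) := by
      refine measure_pi_le_of_update _ hEm ⟨ℓ, hℓ'⟩ fun W => ?_
      by_cases hW : ∀ i j, |gramAvg (activation σ W x ℓ hℓ')
          (tangent σ W x z ℓ hℓ') i j - momentMatrix σ x z ℓ i j| < δ
      · refine (measure_mono ?_).trans (hC _ _ (activation σ W x ℓ hℓ') (tangent σ W x z ℓ hℓ') hw
          (activation_eq_zero W x z hσ hn₀ ℓ hℓ') hW)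
        rintro u ⟨-, i, j, hij⟩
        refine ⟨i, j, ?_⟩
        have e1 : activation σ (Function.update W ⟨ℓ, hℓ'⟩ u) x (ℓ + 1) hℓ = fun r =>
            σ (1 / Real.sqrt (layerWidth n₀ w ℓ) * (u r ⬝ᵥ activation σ W x ℓ hℓ')) := by
          funext r
          rw [activation_succ, activation_update _ _ _ _ _ _ _ le_rfl, Function.update_self]
        have e2 : tangent σ (Function.update W ⟨ℓ, hℓ'⟩ u) x z (ℓ + 1) hℓ = fun r =>
            deriv σ (1 / Real.sqrt (layerWidth n₀ w ℓ) * (u r ⬝ᵥ activation σ W x ℓ hℓ')) *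
              (1 / Real.sqrt (layerWidth n₀ w ℓ) * (u r ⬝ᵥ tangent σ W x z ℓ hℓ')) := by
          funext r
          rw [tangent_succ, activation_update _ _ _ _ _ _ _ le_rfl,
            tangent_update _ _ _ _ _ _ _ _ le_rfl, Function.update_self]
        rw [e1, e2] at hij
        exact hij
      · refine (measure_mono_null (t := ∅) ?_ measure_empty).trans_le zero_le
        rintro u ⟨hu, -⟩
        rw [activation_update _ _ _ _ _ _ _ le_rfl, tangent_update _ _ _ _ _ _ _ _ le_rfl] at hu
        exact hW hu
    refine (measure_mono (t := _ ∪ E) ?_).trans ((measure_union_le _ _).trans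
      (add_le_add le_rfl hEle))
    intro W hW
    by_cases h : ∀ i j, |gramAvg (activation σ W x ℓ hℓ')
          (tangent σ W x z ℓ hℓ') i j - momentMatrix σ x z ℓ i j| < δ
    · exact Or.inr ⟨h, hW⟩
    · left
      push Not at h
      exact h

end Convergence

/-! ### Nets on the sphere and operator norms -/

/-- A `1/2`-separated subset of the sphere of maximal cardinality is a `1/2`-net. -/
theorem exists_sphere_net (d : ℕ) : ∃ N : Finset (EuclideanSpace ℝ (Fin d)), N.card ≤ 5 ^ d ∧
    (∀ y ∈ N, ‖y‖ = 1) ∧ ∀ z : EuclideanSpace ℝ (Fin d), ‖z‖ = 1 → ∃ y ∈ N, ‖z - y‖ ≤ 1 / 2 := by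
  classical
  let Q : Finset (EuclideanSpace ℝ (Fin d)) → Prop := fun N =>
    (∀ y ∈ N, ‖y‖ = 1) ∧ ∀ y ∈ N, ∀ z ∈ N, y ≠ z → 1 / 2 ≤ ‖y - z‖
  have hcard : ∀ N, Q N → N.card ≤ 5 ^ d := fun N ⟨h1, h2⟩ => by
    have hinj : Function.Injective fun y : EuclideanSpace ℝ (Fin d) => (2 : ℝ) • y :=
      smul_right_injective _ two_ne_zero
    -- Doubling gives points of norm `2` at mutual distance at least `1`, the normalization of this
    -- packing bound.
    have := Besicovitch.card_le_of_separated (N.image fun y => (2 : ℝ) • y) (by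
      simp only [Finset.mem_image, forall_exists_index, and_imp, forall_apply_eq_imp_iff₂]
      intro y hy
      simp [norm_smul, h1 y hy]) (by
      simp only [Finset.mem_image, forall_exists_index, and_imp, forall_apply_eq_imp_iff₂]
      intro y hy z hz hne
      have := h2 y hy z hz fun h => hne (by rw [h])
      rw [← smul_sub, norm_smul, Real.norm_ofNat]
      linarith)
    rwa [Finset.card_image_of_injective _ hinj, finrank_euclideanSpace_fin] at this
  let P : ℕ → Prop := fun k => ∃ N, Q N ∧ N.card = k
  have h0 : P 0 := ⟨∅, ⟨by simp, by simp⟩, rfl⟩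
  obtain ⟨N, hN, hNc⟩ := Nat.findGreatest_spec (P := P) (Nat.zero_le (5 ^ d)) h0
  refine ⟨N, hcard N hN, hN.1, fun z hz => ?_⟩
  by_contra! hcon
  have hzN : z ∉ N := fun h => by
    have := hcon z h
    norm_num at this
  have hQ : Q (insert z N) := by
    refine ⟨fun y hy => ?_, fun y hy y' hy' hne => ?_⟩
    · rcases Finset.mem_insert.1 hy with rfl | h
      · exact hz
      · exact hN.1 y h
    · rcases Finset.mem_insert.1 hy with rfl | h <;> rcases Finset.mem_insert.1 hy' with rfl | h'
      · exact absurd rfl hne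
      · exact (hcon y' h').le
      · rw [norm_sub_rev]
        exact (hcon y h).le
      · exact hN.2 y h y' h' hne
  have := Nat.le_findGreatest (P := P) (hcard _ hQ) ⟨_, hQ, rfl⟩
  rw [Finset.card_insert_of_notMem hzN, hNc] at this
  omega

/-- Approximation by the net gives `‖L‖ ≤ b + ‖L‖ / 2`, and the last term is absorbed. -/
theorem l2_opNorm_le_of_net {p d : ℕ} (A : Matrix (Fin p) (Fin d) ℝ)
    {N : Finset (EuclideanSpace ℝ (Fin d))}
    (hN : ∀ z : EuclideanSpace ℝ (Fin d), ‖z‖ = 1 → ∃ y ∈ N, ‖z - y‖ ≤ 1 / 2) {b : ℝ} (hb : 0 ≤ b)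
    (h : ∀ y ∈ N, ∑ i, ((A *ᵥ fun j => y j) i) ^ 2 ≤ b ^ 2) : ‖A‖ ≤ 2 * b := by
  rw [Matrix.l2_opNorm_def]
  set L := (Matrix.toEuclideanLin (𝕜 := ℝ) (m := Fin p) (n := Fin d)).trans
    LinearMap.toContinuousLinearMap A with hL
  have hy : ∀ y ∈ N, ‖L y‖ ≤ b := fun y hy => by
    refine abs_le_of_sq_le_sq' ?_ hb |>.2
    rw [EuclideanSpace.real_norm_sq_eq]
    exact h y hy
  have : ‖L‖ ≤ b + ‖L‖ / 2 := by
    refine ContinuousLinearMap.opNorm_le_of_unit_norm (by positivity) fun z hz => ?_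
    obtain ⟨y, hyN, hzy⟩ := hN z hz
    have h1 : L z = L y + L (z - y) := by rw [map_sub]; abel
    rw [h1]
    refine (norm_add_le _ _).trans (add_le_add (hy y hyN) ((L.le_opNorm _).trans ?_))
    nlinarith [norm_nonneg L]
  linarith

/-! ### Exponential tails for sums of squared Gaussians -/

theorem lintegral_exp_sq_gaussianReal_le {c s : ℝ} (hc : 0 < c) (hs : 0 < s) {V : NNReal}
    (hV : (V : ℝ) ≤ s) :
    ∫⁻ y, ENNReal.ofReal (Real.exp (c * y ^ 2 / s)) ∂gaussianReal 0 V ≤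
      ∫⁻ y, ENNReal.ofReal (Real.exp (c * y ^ 2)) ∂gaussianReal 0 1 := by
  have h : gaussianReal 0 V = (gaussianReal 0 1).map (fun y => Real.sqrt V * y) := by
    rw [gaussianReal_map_const_mul]
    congr 1
    · simp
    · ext
      simp
  rw [h, lintegral_map (by fun_prop) (by fun_prop)]
  refine lintegral_mono fun y => ENNReal.ofReal_le_ofReal (Real.exp_le_exp.2 ?_)
  rw [div_le_iff₀ hs, mul_pow, Real.sq_sqrt (NNReal.coe_nonneg V), mul_comm (V : ℝ), ← mul_assoc]
  gcongr

theorem map_dotProduct_gaussian {m : ℕ} (v : Fin m → ℝ) :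
    (Measure.pi fun _ : Fin m => gaussianReal 0 1).map
      (fun u => 1 / Real.sqrt m * (u ⬝ᵥ v)) = gaussianReal 0 ((v ⬝ᵥ v) / m).toNNReal := by
  have h := (pairLaw_marginal (posSemidef_gramAvg v v) 0).map_eq
  have hmeas : Measurable fun u : Fin m → ℝ =>
      (!₂[1 / Real.sqrt m * (u ⬝ᵥ v), 1 / Real.sqrt m * (u ⬝ᵥ v)] : EuclideanSpace ℝ (Fin 2)) := by
    refine (WithLp.measurable_toLp 2 (Fin 2 → ℝ)).comp (measurable_pi_lambda _ fun i => ?_)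
    fin_cases i <;> simp [dotProduct] <;> fun_prop
  rw [← map_dotProduct_pair, Measure.map_map (by fun_prop) hmeas] at h
  exact h

theorem lintegral_prod_pi_eq_pow {Ω : Type*} [MeasurableSpace Ω] (γ : Measure Ω)
    [IsProbabilityMeasure γ] {f : Ω → ENNReal} (hf : Measurable f) (n : ℕ) :
    ∫⁻ U, ∏ r, f (U r) ∂(Measure.pi fun _ : Fin n => γ) = (∫⁻ u, f u ∂γ) ^ n := by
  have hind : iIndepFun (fun r (U : Fin n → Ω) => f (U r)) (Measure.pi fun _ : Fin n => γ) :=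
    iIndepFun_pi (X := fun _ : Fin n => f) fun _ => hf.aemeasurable
  rw [lintegral_prod_eq_prod_lintegral_of_indepFun Finset.univ _ hind
    fun r => hf.comp (measurable_pi_apply r)]
  rw [Finset.prod_congr rfl fun r _ =>
    (measurePreserving_eval (fun _ : Fin n => γ) r).lintegral_comp hf]
  simp

/-- Chernoff's method: the exponential moment of the sum factors over the independent rows, and each
factor is at most `D`. -/
theorem measure_sum_sq_gaussian_gt_le {m n : ℕ} (v : Fin m → ℝ) {a c s D : ℝ} (hc : 0 < c)
    (hs : 0 < s) (hv : (v ⬝ᵥ v) / m ≤ s)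
    (hD : ∫⁻ y, ENNReal.ofReal (Real.exp (c * y ^ 2)) ∂gaussianReal 0 1 ≤ ENNReal.ofReal D) :
    (Measure.pi fun _ : Fin n => Measure.pi fun _ : Fin m => gaussianReal 0 1)
      {U | a * s * n < ∑ r, (1 / Real.sqrt m * (U r ⬝ᵥ v)) ^ 2} ≤
      ENNReal.ofReal (D * Real.exp (-(c * a))) ^ n := by
  set γ : Measure (Fin m → ℝ) := Measure.pi fun _ : Fin m => gaussianReal 0 1
  set f : (Fin m → ℝ) → ENNReal := fun u =>
    ENNReal.ofReal (Real.exp (c * (1 / Real.sqrt m * (u ⬝ᵥ v)) ^ 2 / s)) with hf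
  have hmeas : Measurable fun u : Fin m → ℝ => 1 / Real.sqrt m * (u ⬝ᵥ v) := by
    simp only [dotProduct]
    fun_prop
  have hfm : Measurable f := by fun_prop
  have hf1 : ∫⁻ u, f u ∂γ ≤ ENNReal.ofReal D := by
    have h := lintegral_map (μ := γ) (f := fun y => ENNReal.ofReal (Real.exp (c * y ^ 2 / s)))
      (by fun_prop) hmeas
    rw [map_dotProduct_gaussian] at h
    rw [hf, ← h]
    have hpos : 0 ≤ (v ⬝ᵥ v) / m :=
      div_nonneg (by simpa using dotProduct_star_self_nonneg v) (Nat.cast_nonneg m)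
    exact (lintegral_exp_sq_gaussianReal_le hc hs (by rwa [Real.coe_toNNReal _ hpos])).trans hD
  have hprod : ∫⁻ U, ∏ r, f (U r) ∂(Measure.pi fun _ : Fin n => γ) ≤ ENNReal.ofReal D ^ n := by
    rw [lintegral_prod_pi_eq_pow γ hfm]
    gcongr
  have hexp : ENNReal.ofReal (Real.exp (c * a)) ^ n ≠ 0 :=
    pow_ne_zero _ (by simpa using Real.exp_pos _)
  have hexp' : ENNReal.ofReal (Real.exp (c * a)) ^ n ≠ ⊤ := ENNReal.pow_ne_top ENNReal.ofReal_ne_top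
  have hPm : Measurable fun U : Fin n → Fin m → ℝ => ∏ r, f (U r) :=
    Finset.measurable_fun_prod _ fun r _ => hfm.comp (measurable_pi_apply r)
  have hsub : {U : Fin n → Fin m → ℝ | a * s * n < ∑ r, (1 / Real.sqrt m * (U r ⬝ᵥ v)) ^ 2} ⊆
      {U | ENNReal.ofReal (Real.exp (c * a)) ^ n ≤ ∏ r, f (U r)} := by
    intro U hU
    simp only [Set.mem_ofPred_eq] at hU ⊢
    rw [← ENNReal.ofReal_prod_of_nonneg fun _ _ => (Real.exp_pos _).le,
      ← ENNReal.ofReal_pow (Real.exp_pos _).le, ← Real.exp_sum, ← Real.exp_nat_mul]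
    refine ENNReal.ofReal_le_ofReal (Real.exp_le_exp.2 ?_)
    rw [← Finset.sum_div, ← Finset.mul_sum, le_div_iff₀ hs]
    nlinarith
  have hmarkov := meas_ge_le_lintegral_div (μ := Measure.pi fun _ : Fin n => γ) hPm.aemeasurable
    hexp hexp'
  have hfin : (∫⁻ U, ∏ r, f (U r) ∂(Measure.pi fun _ : Fin n => γ)) /
      ENNReal.ofReal (Real.exp (c * a)) ^ n ≤ ENNReal.ofReal (D * Real.exp (-(c * a))) ^ n := by
    rw [ENNReal.div_le_iff hexp hexp']
    refine hprod.trans_eq ?_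
    rw [← mul_pow, ← ENNReal.ofReal_mul' (Real.exp_pos _).le, mul_assoc, ← Real.exp_add]
    simp
  exact (measure_mono hsub).trans (hmarkov.trans hfin)

/-! ### Bounds on `τ` -/

theorem layerMoment_one_one_le {σ : ℝ → ℝ} {L : ℝ} (hL : ∀ y, |deriv σ y| ≤ L)
    {S : Matrix (Fin 2) (Fin 2) ℝ} (hS : S.PosSemidef) :
    layerMoment σ S 1 1 ≤ L ^ 2 * S 1 1 := by
  have hmp := pairLaw_marginal hS 1
  have h2 : ∫ p, p 1 ^ 2 ∂pairLaw S = S 1 1 := by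
    have h := integral_sq_gaussianReal (S 1 1).toNNReal
    rw [← hmp.map_eq, integral_map (by fun_prop) (by fun_prop),
      Real.coe_toNNReal _ hS.diag_nonneg] at h
    exact h
  have hint : Integrable (fun p => p 1 ^ 2) (pairLaw S) :=
    (hmp.integrable_comp (g := fun y : ℝ => y ^ 2) (by fun_prop)).2 (integrable_sq_gaussianReal _)
  rw [← h2, ← integral_const_mul]
  refine integral_mono_of_nonneg (Eventually.of_forall fun _ => sq_nonneg _)
    (hint.const_mul _) (Eventually.of_forall fun p => ?_)
  simp only [mul_pow]
  have h := pow_le_pow_left₀ (abs_nonneg _) (hL (p 0)) 2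
  rw [sq_abs] at h
  gcongr

theorem limitSecondMoment_le {σ : ℝ → ℝ} {K : NNReal} (hσ : LipschitzWith K σ) {L : ℝ}
    (hL : ∀ y, |deriv σ y| ≤ L) {n₀ : ℕ} (x z : EuclideanSpace ℝ (Fin n₀)) (hz : ‖z‖ = 1) (ℓ : ℕ) :
    limitSecondMoment σ x z ℓ ≤ (L ^ 2) ^ ℓ / n₀ := by
  induction ℓ with
  | zero => simp [limitSecondMoment, momentMatrix, hz]
  | succ ℓ ih =>
    rw [limitSecondMoment, momentMatrix_succ]
    refine (layerMoment_one_one_le hL (posSemidef_momentMatrix hσ x z ℓ)).trans ?_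
    refine (mul_le_mul_of_nonneg_left ih (sq_nonneg L)).trans_eq ?_
    rw [pow_succ]
    ring

theorem limitSecondMoment_nonneg {σ : ℝ → ℝ} {K : NNReal} (hσ : LipschitzWith K σ) {n₀ : ℕ}
    (x z : EuclideanSpace ℝ (Fin n₀)) (ℓ : ℕ) : 0 ≤ limitSecondMoment σ x z ℓ :=
  (posSemidef_momentMatrix hσ x z ℓ).diag_nonneg

theorem tau_nonneg {σ : ℝ → ℝ} {K : NNReal} (hσ : LipschitzWith K σ) {n₀ n : ℕ}
    (X : Fin n → EuclideanSpace ℝ (Fin n₀)) (H : ℕ) : 0 ≤ tau σ X H := by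
  refine Real.sSup_nonneg ?_
  rintro t ⟨i, z, -, rfl⟩
  exact limitSecondMoment_nonneg hσ _ _ _

theorem limitSecondMoment_le_tau {σ : ℝ → ℝ} {K : NNReal} (hσ : LipschitzWith K σ) {n₀ n : ℕ}
    (X : Fin n → EuclideanSpace ℝ (Fin n₀)) (H : ℕ) (i : Fin n) {z : EuclideanSpace ℝ (Fin n₀)}
    (hz : ‖z‖ = 1) : limitSecondMoment σ (X i) z H ≤ tau σ X H := by
  -- Boundedness is needed, since `sSup` of an unbounded set of reals is `0`.
  refine le_csSup ⟨((K : ℝ) ^ 2) ^ H / n₀, ?_⟩ ⟨i, z, hz, rfl⟩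
  rintro t ⟨i, z, hz, rfl⟩
  exact limitSecondMoment_le hσ (abs_deriv_le hσ) _ _ hz _

theorem tau_le {σ : ℝ → ℝ} {K : NNReal} (hσ : LipschitzWith K σ) {L : ℝ}
    (hL : ∀ y, |deriv σ y| ≤ L) {n₀ n : ℕ} (X : Fin n → EuclideanSpace ℝ (Fin n₀)) (H : ℕ) :
    tau σ X H ≤ (L ^ 2) ^ H / n₀ := by
  -- Nonnegativity of the bound covers the empty set, for instance when `n = 0`.
  refine Real.sSup_le ?_ (by positivity)
  rintro t ⟨i, z, hz, rfl⟩
  exact limitSecondMoment_le hσ hL _ _ hz _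

theorem abs_deriv_sigmoid_le (y : ℝ) : |deriv Real.sigmoid y| ≤ 1 / 4 := by
  rw [Real.deriv_sigmoid, abs_of_nonneg]
  · nlinarith [sq_nonneg (Real.sigmoid y - 1 / 2)]
  · exact mul_nonneg (Real.sigmoid_nonneg y) (sub_nonneg.2 (Real.sigmoid_le_one y))

theorem lipschitzWith_sigmoid : LipschitzWith (1 / 4) Real.sigmoid :=
  lipschitzWith_of_nnnorm_deriv_le differentiable_sigmoid fun y => by
    rw [← NNReal.coe_le_coe]
    simpa using abs_deriv_sigmoid_le y

theorem layerWidth_last (n₀ : ℕ) {H : ℕ} (w : Fin H → ℕ) : layerWidth n₀ w (H + 1) = n₀ := by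
  simp [layerWidth]

/-! ### From a single direction to the operator norm -/

theorem eventually_measure_jacobian_mulVec_le {σ : ℝ → ℝ} {K : NNReal} (hσ : LipschitzWith K σ)
    {n₀ : ℕ} (H : ℕ) (hn₀ : 0 < n₀) (x z : EuclideanSpace ℝ (Fin n₀)) {t a c D : ℝ} (ht : 0 ≤ t)
    (hxz : limitSecondMoment σ x z H ≤ t) (hc : 0 < c)
    (hD : ∫⁻ y, ENNReal.ofReal (Real.exp (c * y ^ 2)) ∂gaussianReal 0 1 ≤ ENNReal.ofReal D)
    {η : ENNReal} (hη : 0 < η) :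
    ∀ᶠ w : Fin H → ℕ in atTop, initLaw n₀ w
      {W | a * (2 * t) * n₀ < ∑ r, ((jacobian σ W x *ᵥ fun j => z j) r) ^ 2} ≤
      η + ENNReal.ofReal (D * Real.exp (-(c * a))) ^ n₀ := by
  have hH := Nat.lt_succ_self H
  -- For `t = 0` convergence in probability leaves no room, but the tangent vanishes exactly. For `t
  -- > 0` an error below `t` keeps its mean square below `2t`.
  rcases ht.eq_or_lt with rfl | ht
  · have h0 : momentMatrix σ x z H 1 1 = 0 :=
      le_antisymm hxz (posSemidef_momentMatrix hσ x z H).diag_nonneg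
    refine Eventually.of_forall fun w => ?_
    refine (measure_mono_null (t := ∅) (fun W hW => ?_) measure_empty).trans_le zero_le
    simp [jacobian_mulVec, tangent_eq_zero W x z hσ hn₀ H hH h0] at hW
  have hσm := hσ.continuous.measurable
  filter_upwards [(tendsto_measure_gramAvg hσ hn₀ x z H hH ht).eventually (eventually_le_nhds hη)]
    with w hw
  set k := layerWidth n₀ w H with hk
  set E : Set (Weights n₀ w) := {W | gramAvg (activation σ W x H hH) (tangent σ W x z H hH) 1 1 <
    2 * t} ∩ {W | a * (2 * t) * n₀ < ∑ r, (1 / Real.sqrt k *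
      (W ⟨H, hH⟩ r ⬝ᵥ tangent σ W x z H hH)) ^ 2} with hE
  have hEm : MeasurableSet E := by
    refine (measurableSet_lt (measurable_gramAvg hσm x z H hH 1 1) measurable_const).inter
      (measurableSet_lt measurable_const ?_)
    have := measurable_tangent (w := w) hσm x z H hH
    simp only [dotProduct]
    fun_prop
  have hlast : ((layerWidth n₀ w (H + 1) : ℕ) : ℝ) = n₀ := by rw [layerWidth_last]
  have hEle : initLaw n₀ w E ≤ ENNReal.ofReal (D * Real.exp (-(c * a))) ^ n₀ := by
    refine measure_pi_le_of_update _ hEm ⟨H, hH⟩ fun W => ?_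
    by_cases hW : gramAvg (activation σ W x H hH) (tangent σ W x z H hH) 1 1 < 2 * t
    · have h := measure_sum_sq_gaussian_gt_le (n := layerWidth n₀ w (H + 1)) (a := a)
        (tangent σ W x z H hH) hc (show 0 < 2 * t by positivity) hW.le hD
      refine (measure_mono ?_).trans (h.trans_eq (by rw [layerWidth_last]))
      rintro u ⟨-, hu⟩
      simp only [Set.mem_ofPred_eq, tangent_update _ _ _ _ _ _ _ _ le_rfl,
        Function.update_self] at hu ⊢
      rw [hlast]
      exact hu
    · refine (measure_mono_null (t := ∅) ?_ measure_empty).trans_le zero_le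
      rintro u ⟨hu, -⟩
      rw [Set.mem_ofPred_eq, activation_update _ _ _ _ _ _ _ le_rfl,
        tangent_update _ _ _ _ _ _ _ _ le_rfl] at hu
      exact hW hu
  refine (measure_mono (t := _ ∪ E) ?_).trans ((measure_union_le _ _).trans (add_le_add hw hEle))
  intro W hW
  by_cases h : gramAvg (activation σ W x H hH) (tangent σ W x z H hH) 1 1 < 2 * t
  · refine Or.inr ⟨h, ?_⟩
    simp only [Set.mem_ofPred_eq, jacobian_mulVec] at hW ⊢
    exact hW
  · refine Or.inl ⟨1, 1, ?_⟩
    rw [limitSecondMoment] at hxz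
    exact le_trans (by linarith) (le_abs_self _)

/-- The exponent `c` comes from Fernique's theorem. The value `e⁻¹ / 5` is chosen so that its
`n₀`-th power, summed over `5^n₀` net points, leaves `e^(-n₀)`. -/
theorem exists_gaussian_exp_sq_constants : ∃ c a D : ℝ, 0 < c ∧ 0 < a ∧
    ∫⁻ y, ENNReal.ofReal (Real.exp (c * y ^ 2)) ∂gaussianReal 0 1 ≤ ENNReal.ofReal D ∧
    D * Real.exp (-(c * a)) = Real.exp (-1) / 5 := by
  obtain ⟨c, hc, hint⟩ := IsGaussian.exists_integrable_exp_sq (gaussianReal 0 1)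
  simp only [Real.norm_eq_abs, sq_abs] at hint
  set D := ∫ y, Real.exp (c * y ^ 2) ∂gaussianReal 0 1 with hDdef
  have hD : 1 ≤ D := by
    have : ∫ _, (1 : ℝ) ∂gaussianReal 0 1 ≤ D :=
      integral_mono (integrable_const 1) hint fun y => Real.one_le_exp (by positivity)
    simpa using this
  have hlog : 0 < Real.log (5 * D) := Real.log_pos (by linarith)
  refine ⟨c, (Real.log (5 * D) + 1) / c, D, hc, by positivity, ?_, ?_⟩
  · rw [hDdef, ofReal_integral_eq_lintegral_ofReal hint
      (Eventually.of_forall fun _ => (Real.exp_pos _).le)]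
  · have h5 : 0 < 5 * D := by linarith
    rw [mul_div_cancel₀ _ hc.ne', neg_add, Real.exp_add, Real.exp_neg, Real.exp_log h5]
    field_simp

theorem exists_jacobian_norm_bound : ∃ c : ℝ, 0 < c ∧
    ∀ σ : ℝ → ℝ, (∃ K, LipschitzWith K σ) →
      ∀ H n₀ n : ℕ, 0 < n₀ → ∀ X : Fin n → EuclideanSpace ℝ (Fin n₀),
        ∀ᶠ w : Fin H → ℕ in atTop,
          1 - 2 * n * Real.exp (-(1 * n₀)) ≤ (initLaw n₀ w).real
            {W | ∀ i : Fin n, ‖jacobian σ W (X i)‖ ≤ c * Real.sqrt (n₀ * tau σ X H)} := by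
  obtain ⟨c, a, D, hc, ha, hD, hca⟩ := exists_gaussian_exp_sq_constants
  -- The factor `2` is the loss from the net, and `√(2a)` comes from the threshold `a * (2τ) * n₀`.
  refine ⟨2 * Real.sqrt (2 * a), by positivity, ?_⟩
  rintro σ ⟨K, hσ⟩ H n₀ n hn₀ X
  obtain ⟨N, hNc, hN1, hN⟩ := exists_sphere_net n₀
  set ρ : ENNReal := ENNReal.ofReal (Real.exp (-1) / 5) with hρ
  have hρ0 : 0 < ρ ^ n₀ := ENNReal.pow_pos (ENNReal.ofReal_pos.2 (by positivity)) _
  have hτ := tau_nonneg hσ X H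
  -- One `ρ ^ n₀` is the Chernoff bound; the other is the tolerance `η` for the Gram matrix being
  -- far from its limit, whence the constant `2` in front of `n`.
  have hall : ∀ᶠ w : Fin H → ℕ in atTop, ∀ i : Fin n, ∀ y ∈ N, initLaw n₀ w
      {W | a * (2 * tau σ X H) * n₀ < ∑ r, ((jacobian σ W (X i) *ᵥ fun j => y j) r) ^ 2} ≤
      ρ ^ n₀ + ρ ^ n₀ := by
    rw [eventually_all]
    intro i
    rw [Filter.eventually_all_finset]
    intro y hy
    have := eventually_measure_jacobian_mulVec_le hσ H hn₀ (X i) y (a := a) hτ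
      (limitSecondMoment_le_tau hσ X H i (hN1 y hy)) hc hD hρ0
    rwa [hca] at this
  filter_upwards [hall] with w hw
  set bad : Set (Weights n₀ w) := ⋃ i : Fin n, ⋃ y ∈ N,
    {W | a * (2 * tau σ X H) * n₀ < ∑ r, ((jacobian σ W (X i) *ᵥ fun j => y j) r) ^ 2} with hbad
  set good : Set (Weights n₀ w) := {W | ∀ i : Fin n, ‖jacobian σ W (X i)‖ ≤
    2 * Real.sqrt (2 * a) * Real.sqrt (n₀ * tau σ X H)} with hgood
  -- A covering and subadditivity suffice, so no measurability of `good` is needed.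
  have hcover : Set.univ ⊆ good ∪ bad := by
    intro W _
    by_cases hW : W ∈ bad
    · exact Or.inr hW
    refine Or.inl fun i => ?_
    simp only [hbad, Set.mem_iUnion, Set.mem_ofPred_eq, not_exists, not_lt] at hW
    have hb := l2_opNorm_le_of_net (jacobian σ W (X i)) hN
      (Real.sqrt_nonneg (a * (2 * tau σ X H) * n₀)) fun y hy => by
        rw [Real.sq_sqrt (by positivity)]
        exact hW i y hy
    refine hb.trans_eq ?_
    rw [mul_assoc 2 (Real.sqrt _), ← Real.sqrt_mul (by positivity)]
    congr 2
    ring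
  have hbadle : initLaw n₀ w bad ≤ ENNReal.ofReal (2 * n * Real.exp (-(1 * n₀))) := by
    calc initLaw n₀ w bad ≤ ∑ _i : Fin n, ∑ _y ∈ N, (ρ ^ n₀ + ρ ^ n₀) := by
          refine (measure_iUnion_fintype_le _ _).trans (Finset.sum_le_sum fun i _ => ?_)
          exact (measure_biUnion_finset_le _ _).trans (Finset.sum_le_sum fun y hy => hw i y hy)
      _ = n * (N.card * (ρ ^ n₀ + ρ ^ n₀)) := by simp only [Finset.sum_const, Finset.card_univ, Fintype.card_fin,
          nsmul_eq_mul]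
      _ ≤ n * ((5 ^ n₀ : ℕ) * (ρ ^ n₀ + ρ ^ n₀)) := by gcongr
      _ = ENNReal.ofReal (2 * n * Real.exp (-(1 * n₀))) := by
          have e : ρ ^ n₀ = ENNReal.ofReal ((Real.exp (-1) / 5) ^ n₀) :=
            (ENNReal.ofReal_pow (by positivity) _).symm
          rw [e, ← ENNReal.ofReal_add (by positivity) (by positivity), ← ENNReal.ofReal_natCast,
            ← ENNReal.ofReal_natCast, ← ENNReal.ofReal_mul (by positivity),
            ← ENNReal.ofReal_mul (by positivity)]
          congr 1
          have e2 : Real.exp (-(1 * (n₀ : ℝ))) = Real.exp (-1) ^ n₀ := by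
            rw [← Real.exp_nat_mul]
            congr 1
            ring
          rw [e2, div_pow]
          push_cast
          field_simp
          ring
  have hreal : (initLaw n₀ w).real bad ≤ 2 * n * Real.exp (-(1 * n₀)) :=
    ENNReal.toReal_le_of_le_ofReal (by positivity) hbadle
  have hone : (1 : ℝ) ≤ (initLaw n₀ w).real good + (initLaw n₀ w).real bad := by
    calc (1 : ℝ) = (initLaw n₀ w).real Set.univ := by simp
      _ ≤ (initLaw n₀ w).real (good ∪ bad) := measureReal_mono hcover
      _ ≤ _ := measureReal_union_le _ _
  linarith

theorem sqrt_mul_tau_sigmoid_le {n₀ n : ℕ} (X : Fin n → EuclideanSpace ℝ (Fin n₀)) (H : ℕ) :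
    Real.sqrt (n₀ * tau Real.sigmoid X H) ≤ 1 / 4 ^ H := by
  refine Real.sqrt_le_iff.2 ⟨by positivity, ?_⟩
  refine (mul_le_mul_of_nonneg_left (tau_le lipschitzWith_sigmoid abs_deriv_sigmoid_le X H)
    (Nat.cast_nonneg n₀)).trans ?_
  have e : ((1 : ℝ) / 4 ^ H) ^ 2 = ((1 / 4) ^ 2) ^ H := by
    rw [← one_div_pow, ← pow_mul, ← pow_mul, mul_comm]
  rw [e]
  rcases Nat.eq_zero_or_pos n₀ with h | h
  · simp only [h, Nat.cast_zero, zero_mul]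
    positivity
  · rw [mul_div_cancel₀ _ (by positivity)]

/-- Depth `L = H + 1`; the constants `c`, `C`, `κ` are absolute. The limit of infinite hidden
widths is the filter `atTop` on the width vectors: all hidden widths tend to infinity jointly. -/
theorem theorem1 :
    ∃ c C κ : ℝ, 0 < c ∧ 0 < C ∧ 0 < κ ∧
      (∀ σ : ℝ → ℝ, (∃ K, LipschitzWith K σ) →
        ∀ H n₀ n : ℕ, 0 < n₀ → ∀ X : Fin n → EuclideanSpace ℝ (Fin n₀),
          ∀ᶠ w : Fin H → ℕ in atTop,
            1 - C * n * Real.exp (-(κ * n₀)) ≤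
              (initLaw n₀ w).real
                {W | ∀ i : Fin n, ‖jacobian σ W (X i)‖ ≤ c * Real.sqrt (n₀ * tau σ X H)}) ∧
      (∀ H n₀ n : ℕ, 0 < n₀ → ∀ X : Fin n → EuclideanSpace ℝ (Fin n₀),
        ∀ᶠ w : Fin H → ℕ in atTop,
          1 - C * n * Real.exp (-(κ * n₀)) ≤
            (initLaw n₀ w).real
              {W | ∀ i : Fin n, ‖jacobian Real.sigmoid W (X i)‖ ≤ c / 4 ^ H}) := by
  obtain ⟨c, hc, h⟩ := exists_jacobian_norm_bound
  refine ⟨c, 2, 1, hc, two_pos, one_pos, h, fun H n₀ n hn₀ X => ?_⟩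
  filter_upwards [h Real.sigmoid ⟨_, lipschitzWith_sigmoid⟩ H n₀ n hn₀ X] with w hw
  refine hw.trans (measureReal_mono fun W hW i => (hW i).trans ?_)
  rw [div_eq_mul_one_div]
  exact mul_le_mul_of_nonneg_left (sqrt_mul_tau_sigmoid_le X H) hc.le
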